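/- **Setting.** Let $f:\mathbb R^n\to\mathbb R$ be twice continuously differentiable, $B\in\mathbb R^{p\times n}$, $\lambda_1,\lambda_2>0$, $l\in\mathbb R^n_-$, $u\in\mathbb R^n_+$, $\Omega=\{x: l\le x\le u\}$, and consider $$(1)\qquad \min_x\ F(x)=f(x)+\lambda_1\|Bx\|_0+\lambda_2\|x\|_0\quad\text{s.t. } x\in\Omega .$$ Put $g=\lambda_1\|B\cdot\|_0+\lambda_2\|\cdot\|_0+\delta_\Omega$, $\ \mathrm{prox}_{\mu h}(z)=\arg\min_x\frac1{2\mu}\|x-z\|^2+h(x)$, and $\Pi(z)=\{x\in\Omega:\ \mathrm{supp}(x)\subset\mathrm{supp}(z),\ \mathrm{supp}(Bx)\subset\mathrm{supp}(Bz)\}$. A point $x$ is an $L$-stationary point of (1) if $x\in\mathrm{prox}_{\mu^{-1}g}(x-\mu^{-1}\nabla f(x))$ for some $\mu>0$. Here $\partial$ is the limiting subdifferential, $\mathcal N_C(x)$ is the normal cone of a convex set $C$ at $x$, $\mathrm{ri}$ is the relative interior, $\delta_C$ is the indicator function, and $t_+=\max\{t,0\}$. **Algorithm PGiPN (tolerance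 $0$).** Parameters: $\mu_{\max}>\mu_{\min}>0$, $\tau>1$, $\alpha>0$, $b_1>0$, $b_2\ge1$, $\varrho\in(0,\frac12)$, $\sigma\in(0,\frac12)$, $\varsigma\in(\sigma,1]$, $\beta\in(0,1)$, and $x^0\in\Omega$. For $k=0,1,2,\dots$: * *PG step.* Select $\mu_k\in[\mu_{\min},\mu_{\max}]$. Trying $m=0,1,2,\dots$ in turn, compute a point $\overline x^k\in\mathrm{prox}_{(\mu_k\tau^m)^{-1}g}(x^k-(\mu_k\tau^m)^{-1}\nabla f(x^k))$ until $F(\overline x^k)\le F(x^k)-\frac\alpha2\|x^k-\overline x^k\|^2$; let $m_k$ be the first successful $m$ and $\overline\mu_k=\mu_k\tau^{m_k}$. Stop if $\overline\mu_k\|x^k-\overline x^k\|=0$. If $\mathrm{supp}(x^k)=\mathrm{supp}(\overline x^k)$ and $\mathrm{supp}(Bx^k)=\mathrm{supp}(B\overline x^k)$, go to the Newton step; otherwise $x^{k+1}=\overline x^k$. * *Newton step.* Let $\rho_k=\|\overline\mu_k(x^k-\overline x^k)\|$ and $\Theta_k(y)=f(x^k)+\langle\nabla f(x^k),y-x^k\rangle+\frac12\langle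 y-x^k,G_k(y-x^k)\rangle+\delta_{\Pi(x^k)}(y)$. Find $y^k$ with $\Theta_k(y^k)\le\Theta_k(x^k)$ and $$\mathrm{dist}(0,\partial\Theta_k(y^k))\le\tfrac{\min\{\overline\mu_k^{-1},1\}}2\min\{\rho_k,\rho_k^{1+\varsigma}\}.$$ Set $d^k=y^k-x^k$, let $t_k$ be the smallest integer $t\ge0$ with $f(x^k+\beta^td^k)\le f(x^k)+\varrho\beta^t\langle\nabla f(x^k),d^k\rangle$, and $x^{k+1}=x^k+\beta^{t_k}d^k$. Each matrix $G_k$ is $$G_k^3=\nabla^2f(x^k)+\big(b_2[-\lambda_{\min}(\nabla^2f(x^k))]_++b_1\rho_k^\sigma\big)I,$$ or, when $f(x)=h(Ax-b)$ for some $A\in\mathbb R^{m\times n}$, $b\in\mathbb R^m$ and some separable, twice continuously differentiable $h$ (one such representation being fixed for the whole run), it is $G_k^3$ or one of $$G_k^1=\nabla^2f(x^k)+b_2[-\lambda_{\min}(\nabla^2h(Ax^k-b))]_+A^\top A+b_1\rho_k^\sigma I,\qquad G_k^2=A^\top[\nabla^2h(Ax^k-b)]_+A+b_1\rho_k^\sigma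 I .$$ **Theorem 5.1.** Let $\{x^k\}_{k\in\mathbb N}$ be an infinite sequence generated by PGiPN (so $x^k\ne\overline x^k$ for all $k$). Let $\Gamma(x^0)$ be its set of accumulation points, let $\Pi_*$ be the eventual value of $\Pi(x^k)$, i.e. the set of points lying in $\Pi(x^k)$ for all sufficiently large $k$, and let $\phi=f+\delta_{\Pi_*}$. Suppose that 1. $\nabla^2f$ is locally Lipschitz continuous on an open set containing $\Gamma(x^0)$; 2. $0\in\nabla f(x^*)+\mathrm{ri}(\mathcal N_{\Pi_*}(x^*))$ for every $x^*\in\Gamma(x^0)$; 3. for every sufficiently large $k$ there is $\xi_k\in\mathcal N_{\Pi_*}(x^k)$ such that $$\liminf_{k\to\infty}\frac{-\langle\nabla f(x^k)+\xi_k,d^k\rangle}{\|\nabla f(x^k)+\xi_k\|\,\|d^k\|}>0;$$ 4. $\phi$ is a KL function: at each $\overline x$ with $\partial\phi(\overline x)\neq\emptyset$ there are $\eta\in(0,\infty]$, a neighborhood $\mathcal U$ of $\overline x$ and a continuous concave $\psi:[0,\eta)\to[0,\infty)$, continuously differentiable on $(0,\eta)$ with $\psi(0)=0$ and $\psi'>0$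 on $(0,\eta)$, such that $\psi'(\phi(x)-\phi(\overline x))\,\mathrm{dist}(0,\partial\phi(x))\ge1$ for all $x\in\mathcal U$ with $\phi(\overline x)<\phi(x)<\phi(\overline x)+\eta$. Then $\sum_{k}\|x^{k+1}-x^k\|<\infty$, and consequently $\{x^k\}$ converges to an $L$-stationary point of (1). -/

import Mathlib

open Filter Topology Set

noncomputable section

namespace PGiPN

/-- `ℝⁿ` with the Euclidean norm and inner product. -/
abbrev E (n : ℕ) : Type := EuclideanSpace ℝ (Fin n)

/-! ### Variational analysis for extended real-valued functions -/

open Classical in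
/-- The indicator function `δ_C` (zero on `C`, `+∞` off `C`). -/
def indicatorFun {n : ℕ} (C : Set (E n)) (x : E n) : EReal := if x ∈ C then 0 else ⊤

/-- The proximal mapping `prox_{μ h}(z) = argmin_x (1/(2μ)) ‖x - z‖² + h x`. -/
def prox {n : ℕ} (h : E n → EReal) (μ : ℝ) (z : E n) : Set (E n) :=
  {x | ∀ w : E n, ((1 / (2 * μ) * ‖x - z‖ ^ 2 : ℝ) : EReal) + h x
      ≤ ((1 / (2 * μ) * ‖w - z‖ ^ 2 : ℝ) : EReal) + h w}

/-- The regular (Fréchet) subdifferential of `h` at `x`, a point where `h` is finite: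
`v` belongs to it iff `h w ≥ h x + ⟨v, w - x⟩ - o(‖w - x‖)` as `w → x`. -/
def regularSubdiff {n : ℕ} (h : E n → EReal) (x : E n) : Set (E n) :=
  {v | h x ≠ ⊤ ∧ h x ≠ ⊥ ∧ ∀ ε : ℝ, 0 < ε → ∀ᶠ w in 𝓝 x,
      h x + ((inner ℝ v (w - x) - ε * ‖w - x‖ : ℝ) : EReal) ≤ h w}

/-- The basic (limiting) subdifferential `∂h(x)`: limits of regular subgradients `v_j` at points
`x_j → x` with `h x_j → h x`. It is empty where `h` is not finite. -/
def limitingSubdiff {n : ℕ} (h : E n → EReal) (x : E n) : Set (E n) :=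
  {v | h x ≠ ⊤ ∧ h x ≠ ⊥ ∧ ∃ (xs vs : ℕ → E n), Tendsto xs atTop (𝓝 x) ∧
      Tendsto (fun j => h (xs j)) atTop (𝓝 (h x)) ∧ Tendsto vs atTop (𝓝 v) ∧
      ∀ j, vs j ∈ regularSubdiff h (xs j)}

/-- The normal cone of a convex set `C` at `x` (empty if `x ∉ C`). -/
def normalCone {n : ℕ} (C : Set (E n)) (x : E n) : Set (E n) :=
  {v | x ∈ C ∧ ∀ w ∈ C, inner ℝ v (w - x) ≤ 0}

/-- The class `Υ_η` of desingularizing functions, `η ∈ (0, ∞]`: continuous concave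
`ψ : [0, η) → [0, ∞)`, continuously differentiable on `(0, η)`, with `ψ 0 = 0` and `ψ' > 0` on
`(0, η)`. The values of `ψ` outside `[0, η)` are irrelevant. -/
structure IsDesingularizing (η : EReal) (ψ : ℝ → ℝ) : Prop where
  continuousOn : ContinuousOn ψ {s : ℝ | 0 ≤ s ∧ (s : EReal) < η}
  concaveOn : ConcaveOn ℝ {s : ℝ | 0 ≤ s ∧ (s : EReal) < η} ψ
  nonneg : ∀ s : ℝ, 0 ≤ s → (s : EReal) < η → 0 ≤ ψ s
  contDiffOn : ContDiffOn ℝ 1 ψ {s : ℝ | 0 < s ∧ (s : EReal) < η}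
  zero : ψ 0 = 0
  deriv_pos : ∀ s : ℝ, 0 < s → (s : EReal) < η → 0 < deriv ψ s

/-- The Kurdyka-Łojasiewicz property of `h` at `z`. The distance to the empty set is `+∞`. -/
def HasKLPropertyAt {n : ℕ} (h : E n → EReal) (z : E n) : Prop :=
  ∃ η : EReal, 0 < η ∧ ∃ U ∈ 𝓝 z, ∃ ψ : ℝ → ℝ, IsDesingularizing η ψ ∧
    ∀ x ∈ U, h z < h x → h x < h z + η →
      1 ≤ ENNReal.ofReal (deriv ψ ((h x).toReal - (h z).toReal))
            * Metric.infEDist 0 (limitingSubdiff h x)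

/-- `h` is a KL function: it is proper and has the KL property at each point of `dom ∂h`. -/
def IsKLFunction {n : ℕ} (h : E n → EReal) : Prop :=
  (∃ x, h x ≠ ⊤) ∧ (∀ x, h x ≠ ⊥) ∧
    ∀ z, (limitingSubdiff h z).Nonempty → HasKLPropertyAt h z

/-- The Hessian of `f` at `x` as a bilinear form. -/
def hess {n : ℕ} (f : E n → ℝ) (x : E n) : E n →L[ℝ] E n →L[ℝ] ℝ := fderiv ℝ (fderiv ℝ f) x

/-- The Hessian matrix of `f` at `x`, whose entries are the second partial derivatives. -/
def hessMatrix {n : ℕ} (f : E n → ℝ) (x : E n) : Matrix (Fin n) (Fin n) ℝ :=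
  Matrix.of fun i j => hess f x (EuclideanSpace.single i 1) (EuclideanSpace.single j 1)

/-- The smallest eigenvalue of a real symmetric matrix. -/
def lambdaMin {m : ℕ} (H : Matrix (Fin m) (Fin m) ℝ) : ℝ := sInf (spectrum ℝ H)

/-! ### The structured `ℓ₀` problem -/

/-- The number of nonzero entries of a vector. -/
def l0norm {m : ℕ} (v : Fin m → ℝ) : ℕ := (Function.support v).ncard

/-- Data of the problem `min f x + λ₁ ‖B x‖₀ + λ₂ ‖x‖₀` subject to `l ≤ x ≤ u`. -/
structure Problem (n p : ℕ) where
  f : E n → ℝ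
  B : Matrix (Fin p) (Fin n) ℝ
  lam₁ : ℝ
  lam₂ : ℝ
  l : Fin n → ℝ
  u : Fin n → ℝ
  contDiff_f : ContDiff ℝ 2 f
  lam₁_pos : 0 < lam₁
  lam₂_pos : 0 < lam₂
  l_nonpos : ∀ i, l i ≤ 0
  u_nonneg : ∀ i, 0 ≤ u i

namespace Problem

variable {n p : ℕ} (P : Problem n p)

/-- The support of `x`. -/
def supp (_P : Problem n p) (x : E n) : Set (Fin n) := Function.support x.ofLp

/-- The support of `B x`. -/
def suppB (x : E n) : Set (Fin p) := Function.support (P.B.mulVec x.ofLp)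

/-- The box `Ω`. -/
def Ω : Set (E n) := {x | ∀ i, P.l i ≤ x i ∧ x i ≤ P.u i}

/-- `λ₁ ‖B x‖₀ + λ₂ ‖x‖₀`. -/
def pen (x : E n) : ℝ :=
  P.lam₁ * (l0norm (P.B.mulVec x.ofLp) : ℝ) + P.lam₂ * (l0norm x.ofLp : ℝ)

/-- The objective `F`. -/
def F (x : E n) : ℝ := P.f x + P.pen x

/-- `g = λ₁ ‖B ·‖₀ + λ₂ ‖·‖₀ + δ_Ω`. -/
def g (x : E n) : EReal := (P.pen x : EReal) + indicatorFun P.Ω x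

/-- The multifunction `Π`. -/
def Pi (z : E n) : Set (E n) :=
  {x | x ∈ P.Ω ∧ P.supp x ⊆ P.supp z ∧ P.suppB x ⊆ P.suppB z}

/-- The set `prox_{μ⁻¹ g}(x - μ⁻¹ ∇f(x))` of proximal gradient points at `x`. -/
def pgPoints (μ : ℝ) (x : E n) : Set (E n) := prox P.g μ⁻¹ (x - μ⁻¹ • gradient P.f x)

/-- `L`-stationary points of the problem. -/
def IsLStationary (x : E n) : Prop := ∃ μ : ℝ, 0 < μ ∧ x ∈ P.pgPoints μ x

/-- The second-order model `Θ` of `f + δ_{Π(x)}` at `x` with matrix `G`. -/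
def Theta (G : Matrix (Fin n) (Fin n) ℝ) (x : E n) (y : E n) : EReal :=
  ((P.f x + inner ℝ (gradient P.f x) (y - x)
      + 1 / 2 * inner ℝ (y - x) (Matrix.toEuclideanLin G (y - x)) : ℝ) : EReal)
    + indicatorFun (P.Pi x) y

/-- The switch condition: `x` and `xbar` have the same structured supports. -/
def Switch (x xbar : E n) : Prop := P.supp x = P.supp xbar ∧ P.suppB x = P.suppB xbar

end Problem

/-! ### The algorithm -/

/-- The parameters of the algorithm. -/
structure Params where
  μmin : ℝ
  μmax : ℝ
  τ : ℝ
  α : ℝ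
  b₁ : ℝ
  b₂ : ℝ
  ϱ : ℝ
  σ : ℝ
  ς : ℝ
  β : ℝ
  μmin_pos : 0 < μmin
  μmin_lt : μmin < μmax
  one_lt_τ : 1 < τ
  α_pos : 0 < α
  b₁_pos : 0 < b₁
  one_le_b₂ : 1 ≤ b₂
  ϱ_mem : ϱ ∈ Ioo (0 : ℝ) (1 / 2)
  σ_mem : σ ∈ Ioo (0 : ℝ) (1 / 2)
  ς_mem : ς ∈ Ioc σ 1
  β_mem : β ∈ Ioo (0 : ℝ) 1

/-- A representation `f x = h (A x - b)` with `h z = ∑ i, hᵢ (zᵢ)` separable and `C²`. -/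
structure SepRepr {n : ℕ} (f : E n → ℝ) where
  m : ℕ
  A : Matrix (Fin m) (Fin n) ℝ
  b : Fin m → ℝ
  h : Fin m → ℝ → ℝ
  contDiff_h : ∀ i, ContDiff ℝ 2 (h i)
  f_eq : ∀ x : E n, f x = ∑ i, h i ((A.mulVec x.ofLp - b) i)

/-- The diagonal of `∇²h (A x - b)`. -/
def SepRepr.hessDiag {n : ℕ} {f : E n → ℝ} (S : SepRepr f) (x : E n) : Fin S.m → ℝ :=
  fun i => iteratedDeriv 2 (S.h i) ((S.A.mulVec x.ofLp - S.b) i)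

/-- `G¹ = ∇²f(x) + b₂ [-λ_min(∇²h(A x - b))]₊ Aᵀ A + b₁ r^σ I`. -/
def G₁ {n : ℕ} {f : E n → ℝ} (θ : Params) (S : SepRepr f) (x : E n) (r : ℝ) :
    Matrix (Fin n) (Fin n) ℝ :=
  hessMatrix f x
    + (θ.b₂ * max (-lambdaMin (Matrix.diagonal (S.hessDiag x))) 0) • (S.A.transpose * S.A)
    + (θ.b₁ * r ^ θ.σ) • (1 : Matrix (Fin n) (Fin n) ℝ)

/-- `G² = Aᵀ [∇²h(A x - b)]₊ A + b₁ r^σ I`. -/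
def G₂ {n : ℕ} {f : E n → ℝ} (θ : Params) (S : SepRepr f) (x : E n) (r : ℝ) :
    Matrix (Fin n) (Fin n) ℝ :=
  S.A.transpose * Matrix.diagonal (fun i => max (S.hessDiag x i) 0) * S.A
    + (θ.b₁ * r ^ θ.σ) • (1 : Matrix (Fin n) (Fin n) ℝ)

/-- `G³ = ∇²f(x) + (b₂ [-λ_min(∇²f(x))]₊ + b₁ r^σ) I`. -/
def G₃ {n : ℕ} (f : E n → ℝ) (θ : Params) (x : E n) (r : ℝ) : Matrix (Fin n) (Fin n) ℝ :=
  hessMatrix f x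
    + (θ.b₂ * max (-lambdaMin (hessMatrix f x)) 0 + θ.b₁ * r ^ θ.σ)
      • (1 : Matrix (Fin n) (Fin n) ℝ)

/-- An infinite run of the algorithm with tolerance `ε = 0`. At iteration `k`, `x k` is the iterate,
`μ k` the trial value, `m k` the number of backtracking steps of the proximal gradient step,
`xbar k` its output, and, if the Newton step is taken, `G k` is the matrix of the model, `y k` the
inexact solution and `t k` the number of backtracking steps. In the branch in which no Newton step
is taken the values of `G k`, `y k`, `t k` are irrelevant. -/
structure Run {n p : ℕ} (P : Problem n p) (θ : Params) where
  x : ℕ → E n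
  μ : ℕ → ℝ
  m : ℕ → ℕ
  xbar : ℕ → E n
  G : ℕ → Matrix (Fin n) (Fin n) ℝ
  y : ℕ → E n
  t : ℕ → ℕ
  x_zero_mem : x 0 ∈ P.Ω
  μ_mem : ∀ k, μ k ∈ Icc θ.μmin θ.μmax
  xbar_mem : ∀ k, xbar k ∈ P.pgPoints (μ k * θ.τ ^ m k) (x k)
  xbar_descent : ∀ k, P.F (xbar k) ≤ P.F (x k) - θ.α / 2 * ‖x k - xbar k‖ ^ 2
  /-- `m k` is the first accepted exponent: the proximal point that was tried for each smaller
  exponent did not pass the descent test. -/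
  xbar_first : ∀ k, ∀ j < m k, ∃ z ∈ P.pgPoints (μ k * θ.τ ^ j) (x k),
    P.F (x k) - θ.α / 2 * ‖x k - z‖ ^ 2 < P.F z
  /-- The stopping test (with tolerance zero) is never met. -/
  not_stop : ∀ k, 0 < (μ k * θ.τ ^ m k) * ‖x k - xbar k‖
  pg_step : ∀ k, ¬ P.Switch (x k) (xbar k) → x (k + 1) = xbar k
  /-- The matrices `G k` are of one of the three kinds; the two kinds that use a separable
  representation of `f` use the same one throughout the run. -/
  G_choice :
    (∀ k, P.Switch (x k) (xbar k) →
      G k = G₃ P.f θ (x k) ‖(μ k * θ.τ ^ m k) • (x k - xbar k)‖) ∨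
    ∃ S : SepRepr P.f, ∀ k, P.Switch (x k) (xbar k) →
      (G k = G₁ θ S (x k) ‖(μ k * θ.τ ^ m k) • (x k - xbar k)‖ ∨
       G k = G₂ θ S (x k) ‖(μ k * θ.τ ^ m k) • (x k - xbar k)‖ ∨
       G k = G₃ P.f θ (x k) ‖(μ k * θ.τ ^ m k) • (x k - xbar k)‖)
  inexact_value : ∀ k, P.Switch (x k) (xbar k) →
    P.Theta (G k) (x k) (y k) ≤ P.Theta (G k) (x k) (x k)
  inexact_dist : ∀ k, P.Switch (x k) (xbar k) →
    Metric.infEDist 0 (limitingSubdiff (P.Theta (G k) (x k)) (y k)) ≤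
      ENNReal.ofReal (min (μ k * θ.τ ^ m k)⁻¹ 1 / 2 *
        min ‖(μ k * θ.τ ^ m k) • (x k - xbar k)‖
          (‖(μ k * θ.τ ^ m k) • (x k - xbar k)‖ ^ (1 + θ.ς)))
  newton_search : ∀ k, P.Switch (x k) (xbar k) →
    IsLeast {t : ℕ | P.f (x k + θ.β ^ t • (y k - x k)) ≤
      P.f (x k) + θ.ϱ * θ.β ^ t * inner ℝ (gradient P.f (x k)) (y k - x k)} (t k)
  newton_step : ∀ k, P.Switch (x k) (xbar k) →
    x (k + 1) = x k + θ.β ^ t k • (y k - x k)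

namespace Run

variable {n p : ℕ} {P : Problem n p} {θ : Params} (R : Run P θ)

/-- The direction `dᵏ = yᵏ - xᵏ`. -/
def d (k : ℕ) : E n := R.y k - R.x k

/-- `Γ(x⁰)`, the set of accumulation points of the iterates. -/
def accPts : Set (E n) := {z | MapClusterPt z atTop R.x}

/-- `Π_*`, the eventual value of `Π (xᵏ)`: the points that lie in `Π (xᵏ)` for all large `k`. -/
def PiStar : Set (E n) := {z | ∀ᶠ k in atTop, z ∈ P.Pi (R.x k)}

theorem PiStar_eq {C : Set (E n)} (h : ∀ᶠ k in atTop, P.Pi (R.x k) = C) : R.PiStar = C := by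
  ext z
  constructor
  · intro hz
    obtain ⟨k, hk, hk'⟩ := ((show ∀ᶠ k in atTop, z ∈ P.Pi (R.x k) from hz).and h).exists
    exact hk' ▸ hk
  · intro hz
    show ∀ᶠ k in atTop, z ∈ P.Pi (R.x k)
    filter_upwards [h] with k hk
    rw [hk]
    exact hz

/-- `φ = f + δ_{Π_*}`. -/
def phi (z : E n) : EReal := (P.f z : EReal) + indicatorFun R.PiStar z

/-- `∇²f` is locally Lipschitz continuous on an open set containing the accumulation points. -/
def HessLocallyLipschitz : Prop :=
  ∃ O : Set (E n), IsOpen O ∧ R.accPts ⊆ O ∧ LocallyLipschitzOn O (hess P.f)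

/-- Non-degeneracy: `0 ∈ ∇f(z) + ri N_{Π_*}(z)` at every accumulation point `z`. -/
def NonDegenerate : Prop :=
  ∀ z ∈ R.accPts, ∃ v ∈ intrinsicInterior ℝ (normalCone R.PiStar z), gradient P.f z + v = 0

/-- The angle condition. -/
def AngleCondition : Prop :=
  ∃ ξ : ℕ → E n, (∀ᶠ k in atTop, ξ k ∈ normalCone R.PiStar (R.x k)) ∧
    0 < liminf (fun k => -inner ℝ (gradient P.f (R.x k) + ξ k) (R.d k)
      / (‖gradient P.f (R.x k) + ξ k‖ * ‖R.d k‖)) atTop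

end Run

end PGiPN

end

/-! The argument has a global phase, which needs only that f is C² and Ω is compact, and a local
phase, where the four hypotheses enter.

Global phase. Since ∇²f is bounded on Ω, the accepted proximal parameters are bounded
(`exists_mubar_le`), and every model matrix has bounded norm and dominates b₁ρ^σ I
(`exists_isModelMatrix`). Testing the optimality conditions of x̄ᵏ and yᵏ against each other makes ρ
and ‖d‖ comparable up to a factor ρ^σ (`exists_rho_le_norm_d`), and the line search steps are at
least of order ρ^σ (`exists_le_step`). So F decreases by an amount controlled from below by ‖xᵏ -
x̄ᵏ‖, and this residual tends to 0. Near a cluster point z, the supports of x̄ᵏ and Bx̄ᵏ are those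
of z and Bz, while those of xᵏ and Bxᵏ can only be larger. Hence the supports along the iterates
eventually decrease, become constant, and only Newton steps on the fixed polytope Π_* remain
(`exists_forall_switch`).

Local phase. With a Lipschitz Hessian, the errors in the Newton model are o(ρ^σ‖d‖²), because ς > σ
and σ < 1/2; the unit step is then accepted and xᵏ⁺¹ = yᵏ (`eventually_x_succ_eq_y`). Therefore xᵏ
and yᵏ both carry normal vectors close to -∇f(z), a relative interior point of the normal cone at z.
This puts both on the face orthogonal to that cone, so dᵏ is orthogonal to every normal at xᵏ
(`eventually_inner_normal_d_eq_zero`). The vector ξₖ thus drops out of the numerator of the angle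
condition, and the line search gives a decrease of f by at least c‖∇f(xᵏ) + ξₖ‖‖xᵏ⁺¹ - xᵏ‖. As
‖∇f(xᵏ) + ξₖ‖ bounds the slope of φ from above, the KL inequality turns this into a telescoping
bound on ‖xᵏ⁺¹ - xᵏ‖ (`summable_norm_sub_of_KL`). The limit is L-stationary by passing to the limit
in the proximal inequality, the penalty of x̄ᵏ being eventually that of the limit
(`isLStationary_of_tendsto`). -/

noncomputable section

namespace PGiPN

/-! ### Second-order Taylor bounds -/

section Calculus

variable {n : ℕ} {f : E n → ℝ}

theorem differentiableAt_of_contDiff_two (hf : ContDiff ℝ 2 f) (x : E n) :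
    DifferentiableAt ℝ f x :=
  (hf.differentiable (by norm_num)) x

theorem differentiableAt_fderiv_of_contDiff_two (hf : ContDiff ℝ 2 f) (x : E n) :
    DifferentiableAt ℝ (fderiv ℝ f) x :=
  ((hf.fderiv_right (m := 1) (by norm_num)).differentiable (by norm_num)) x

theorem continuous_gradient_of_contDiff_two (hf : ContDiff ℝ 2 f) :
    Continuous (gradient f) :=
  (InnerProductSpace.toDual ℝ (E n)).symm.continuous.comp (hf.continuous_fderiv (by norm_num))

theorem continuous_hess_of_contDiff_two (hf : ContDiff ℝ 2 f) : Continuous (hess f) :=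
  (hf.fderiv_right (m := 1) (by norm_num)).continuous_fderiv (by norm_num)

theorem hasDerivAt_add_smul (x d : E n) (t : ℝ) : HasDerivAt (fun s : ℝ => x + s • d) d t := by
  simpa using ((hasDerivAt_id t).smul_const d).const_add x

theorem hasDerivAt_line (hf : ContDiff ℝ 2 f) (x d : E n) (t : ℝ) :
    HasDerivAt (fun s : ℝ => f (x + s • d)) (fderiv ℝ f (x + t • d) d) t :=
  (differentiableAt_of_contDiff_two hf _).hasFDerivAt.comp_hasDerivAt t (hasDerivAt_add_smul x d t)

theorem hasDerivAt_fderiv_line (hf : ContDiff ℝ 2 f) (x d : E n) (t : ℝ) :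
    HasDerivAt (fun s : ℝ => fderiv ℝ f (x + s • d) d) (hess f (x + t • d) d d) t := by
  have h := (differentiableAt_fderiv_of_contDiff_two hf (x + t • d)).hasFDerivAt.comp_hasDerivAt t
    (hasDerivAt_add_smul x d t)
  simpa [hess] using h.clm_apply (hasDerivAt_const t d)

/-- Two integrations along the segment, each phrased as monotonicity: the function minus the
integrated bound has nonpositive derivative. -/
theorem le_add_inner_gradient_of_hess_le (hf : ContDiff ℝ 2 f) {x d : E n} {M : ℝ}
    (h : ∀ t ∈ Icc (0 : ℝ) 1, hess f (x + t • d) d d ≤ M) :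
    f (x + d) ≤ f x + inner ℝ (gradient f x) d + M / 2 := by
  have h1 : ∀ t, HasDerivAt (fun s : ℝ => fderiv ℝ f (x + s • d) d - M * s)
      (hess f (x + t • d) d d - M) t := fun t => by
    have := (hasDerivAt_fderiv_line hf x d t).sub ((hasDerivAt_id t).const_mul M)
    rw [mul_one] at this
    exact this
  have a1 : AntitoneOn (fun s : ℝ => fderiv ℝ f (x + s • d) d - M * s) (Icc 0 1) := by
    apply antitoneOn_of_deriv_nonpos (convex_Icc 0 1)
    · exact fun t _ => (h1 t).continuousAt.continuousWithinAt
    · exact fun t _ => (h1 t).differentiableAt.differentiableWithinAt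
    · intro t ht
      rw [(h1 t).deriv]
      linarith [h t (interior_subset ht)]
  have h2 : ∀ t, HasDerivAt (fun s : ℝ => f (x + s • d) - fderiv ℝ f x d * s - M / 2 * s ^ 2)
      (fderiv ℝ f (x + t • d) d - fderiv ℝ f x d - M * t) t := fun t => by
    have := ((hasDerivAt_line hf x d t).sub ((hasDerivAt_id t).const_mul (fderiv ℝ f x d))).sub
      ((hasDerivAt_pow 2 t).const_mul (M / 2))
    refine this.congr_deriv ?_
    push_cast
    ring
  have a2 : AntitoneOn (fun s : ℝ => f (x + s • d) - fderiv ℝ f x d * s - M / 2 * s ^ 2)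
      (Icc 0 1) := by
    apply antitoneOn_of_deriv_nonpos (convex_Icc 0 1)
    · exact fun t _ => (h2 t).continuousAt.continuousWithinAt
    · exact fun t _ => (h2 t).differentiableAt.differentiableWithinAt
    · intro t ht
      rw [(h2 t).deriv]
      have := a1 (left_mem_Icc.2 zero_le_one) (interior_subset ht) (interior_subset ht).1
      simp at this
      linarith
  have := a2 (left_mem_Icc.2 zero_le_one) (right_mem_Icc.2 zero_le_one) zero_le_one
  simp at this
  rw [inner_gradient_left]
  linarith

theorem hess_self_le_of_norm_le {x d : E n} {L : ℝ} (h : ‖hess f x‖ ≤ L) :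
    hess f x d d ≤ L * ‖d‖ ^ 2 := by
  have h1 := (hess f x).le_opNorm₂ d d
  have h2 := le_abs_self (hess f x d d)
  rw [Real.norm_eq_abs] at h1
  nlinarith [mul_le_mul_of_nonneg_right h (sq_nonneg ‖d‖)]

theorem le_of_hess_norm_le (hf : ContDiff ℝ 2 f) {S : Set (E n)} (hS : Convex ℝ S) {L : ℝ}
    (hL : ∀ x ∈ S, ‖hess f x‖ ≤ L) {x d : E n} (hx : x ∈ S) (hd : x + d ∈ S) :
    f (x + d) ≤ f x + inner ℝ (gradient f x) d + L / 2 * ‖d‖ ^ 2 := by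
  have := le_add_inner_gradient_of_hess_le hf (x := x) (d := d) (M := L * ‖d‖ ^ 2)
    fun t ht => hess_self_le_of_norm_le (hL _ (hS.add_smul_mem hx hd ht))
  linarith

/-- The Hessian on the segment is compared with that at `x` by the uniform bound `K * ‖d‖`, whence
K/2 instead of the sharp K/6. -/
theorem le_of_hess_lipschitz (hf : ContDiff ℝ 2 f) {S : Set (E n)} (hS : Convex ℝ S) {K : ℝ}
    (hK : ∀ x ∈ S, ∀ y ∈ S, ‖hess f x - hess f y‖ ≤ K * ‖x - y‖) (hK0 : 0 ≤ K) {x d : E n}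
    (hx : x ∈ S) (hd : x + d ∈ S) :
    f (x + d) ≤ f x + inner ℝ (gradient f x) d + hess f x d d / 2 + K / 2 * ‖d‖ ^ 3 := by
  have := le_add_inner_gradient_of_hess_le hf (x := x) (d := d)
    (M := hess f x d d + K * ‖d‖ ^ 3) fun t ht => by
      have h1 := hK _ (hS.add_smul_mem hx hd ht) _ hx
      have h2 := (hess f (x + t • d) - hess f x).le_opNorm₂ d d
      have h3 := le_abs_self ((hess f (x + t • d) - hess f x) d d)
      rw [Real.norm_eq_abs] at h2
      have h4 : ‖x + t • d - x‖ ≤ ‖d‖ := by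
        rw [add_sub_cancel_left, norm_smul, Real.norm_eq_abs, abs_of_nonneg ht.1]
        exact mul_le_of_le_one_left (norm_nonneg _) ht.2
      have h5 : ‖hess f (x + t • d) - hess f x‖ ≤ K * ‖d‖ := h1.trans (by gcongr)
      have h6 : (hess f (x + t • d) - hess f x) d d = hess f (x + t • d) d d - hess f x d d := rfl
      nlinarith [mul_le_mul_of_nonneg_right h5 (sq_nonneg ‖d‖)]
  linarith

end Calculus

/-! ### Normal cones and subdifferentials of smooth functions plus indicators -/

section Subdifferential

variable {n : ℕ} {C : Set (E n)}

theorem indicatorFun_of_mem {x : E n} (h : x ∈ C) : indicatorFun C x = 0 := if_pos h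

theorem indicatorFun_of_notMem {x : E n} (h : x ∉ C) : indicatorFun C x = ⊤ := if_neg h

theorem coe_add_indicatorFun_of_mem {x : E n} (a : ℝ) (h : x ∈ C) :
    (a : EReal) + indicatorFun C x = a := by
  rw [indicatorFun_of_mem h, add_zero]

theorem coe_add_indicatorFun_of_notMem {x : E n} (a : ℝ) (h : x ∉ C) :
    (a : EReal) + indicatorFun C x = ⊤ := by
  rw [indicatorFun_of_notMem h, EReal.coe_add_top]

theorem mem_of_coe_add_indicatorFun_ne_top {x : E n} {a : ℝ}
    (h : (a : EReal) + indicatorFun C x ≠ ⊤) : x ∈ C := by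
  by_contra hx
  exact h (coe_add_indicatorFun_of_notMem a hx)

/-- By convexity the segment from `x` to `w` stays in `C`, so the Fréchet inequality bounds the
difference quotients of `q` along it from below; then ε is arbitrary. -/
theorem sub_gradient_mem_normalCone_of_mem_regularSubdiff {q : E n → ℝ} (hC : Convex ℝ C)
    {x v g : E n} (hq : HasGradientAt q g x)
    (hv : v ∈ regularSubdiff (fun z => (q z : EReal) + indicatorFun C z) x) :
    v - g ∈ normalCone C x := by
  obtain ⟨hx, -, hv⟩ := hv
  have hx : x ∈ C := mem_of_coe_add_indicatorFun_ne_top hx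
  refine ⟨hx, fun w hw => ?_⟩
  have hline : HasDerivAt (fun t : ℝ => q (x + t • (w - x))) (inner ℝ g (w - x)) 0 := by
    have h0 : HasFDerivAt q ((InnerProductSpace.toDual ℝ (E n)) g) (x + (0 : ℝ) • (w - x)) := by
      simpa using hq.hasFDerivAt
    exact h0.comp_hasDerivAt (0 : ℝ) (hasDerivAt_add_smul x (w - x) 0)
  have key : ∀ ε : ℝ, 0 < ε → inner ℝ v (w - x) - ε * ‖w - x‖ ≤ inner ℝ g (w - x) := by
    intro ε hε
    have hslope := hline.tendsto_slope_zero_right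
    refine ge_of_tendsto hslope ?_
    have hcont : Tendsto (fun t : ℝ => x + t • (w - x)) (𝓝[>] 0) (𝓝 x) := by
      have : Tendsto (fun t : ℝ => x + t • (w - x)) (𝓝 0) (𝓝 (x + (0 : ℝ) • (w - x))) :=
        (hasDerivAt_add_smul x (w - x) 0).continuousAt
      simp only [zero_smul, add_zero] at this
      exact this.mono_left nhdsWithin_le_nhds
    filter_upwards [hcont.eventually (hv ε hε), Ioo_mem_nhdsGT (zero_lt_one' ℝ)] with t ht ht1
    have hmem : x + t • (w - x) ∈ C := by
      have := hC.add_smul_sub_mem hx hw (t := t) ⟨ht1.1.le, ht1.2.le⟩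
      exact this
    simp only [coe_add_indicatorFun_of_mem _ hx, coe_add_indicatorFun_of_mem _ hmem] at ht
    rw [← EReal.coe_add, EReal.coe_le_coe_iff, add_sub_cancel_left, inner_smul_right, norm_smul,
      Real.norm_eq_abs, abs_of_pos ht1.1] at ht
    simp only [zero_add, zero_smul, add_zero, smul_eq_mul]
    rw [inv_mul_eq_div, le_div_iff₀ ht1.1]
    nlinarith
  rw [inner_sub_left]
  by_contra hcon
  push Not at hcon
  -- This ε makes ε‖w - x‖ smaller than the supposed excess; the `+ 1` covers w = x.
  have := key ((inner ℝ v (w - x) - inner ℝ g (w - x)) / (2 * (‖w - x‖ + 1))) (by positivity)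
  have h2 : (inner ℝ v (w - x) - inner ℝ g (w - x)) / (2 * (‖w - x‖ + 1)) * ‖w - x‖
      < inner ℝ v (w - x) - inner ℝ g (w - x) := by
    rw [div_mul_eq_mul_div, div_lt_iff₀ (by positivity)]
    nlinarith [norm_nonneg (w - x)]
  linarith

theorem sub_gradient_mem_normalCone_of_mem_limitingSubdiff {q : E n → ℝ} {g : E n → E n}
    (hC : Convex ℝ C) (hq : ∀ x, HasGradientAt q (g x) x) (hg : Continuous g) {x v : E n}
    (hv : v ∈ limitingSubdiff (fun z => (q z : EReal) + indicatorFun C z) x) :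
    v - g x ∈ normalCone C x := by
  obtain ⟨hx, -, xs, vs, hxs, -, hvs, hreg⟩ := hv
  refine ⟨mem_of_coe_add_indicatorFun_ne_top hx, fun w hw => ?_⟩
  have h1 : ∀ j, inner ℝ (vs j - g (xs j)) (w - xs j) ≤ 0 := fun j =>
    (sub_gradient_mem_normalCone_of_mem_regularSubdiff hC (hq _) (hreg j)).2 w hw
  have h2 : Tendsto (fun j => inner ℝ (vs j - g (xs j)) (w - xs j)) atTop
      (𝓝 (inner ℝ (v - g x) (w - x))) :=
    (hvs.sub ((hg.tendsto x).comp hxs)).inner (tendsto_const_nhds.sub hxs)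
  exact le_of_tendsto' h2 h1

theorem gradient_add_mem_limitingSubdiff {q : E n → ℝ} {g x ξ : E n} (hq : HasGradientAt q g x)
    (hξ : ξ ∈ normalCone C x) :
    g + ξ ∈ limitingSubdiff (fun z => (q z : EReal) + indicatorFun C z) x := by
  have hval := coe_add_indicatorFun_of_mem (q x) hξ.1
  have hreg : g + ξ ∈ regularSubdiff (fun z => (q z : EReal) + indicatorFun C z) x := by
    refine ⟨?_, ?_, fun ε hε => ?_⟩
    · simp only [hval]; exact EReal.coe_ne_top _
    · simp only [hval]; exact EReal.coe_ne_bot _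
    have ho := (hasFDerivAt_iff_isLittleO.1 hq.hasFDerivAt).def hε
    filter_upwards [ho] with w hw
    by_cases hwC : w ∈ C
    · simp only [hval, coe_add_indicatorFun_of_mem _ hwC]
      rw [← EReal.coe_add, EReal.coe_le_coe_iff, inner_add_left]
      have h1 := hξ.2 w hwC
      rw [Real.norm_eq_abs] at hw
      have h2 := (abs_le.1 hw).1
      simp only [InnerProductSpace.toDual_apply_apply] at h2
      linarith
    · simp only [coe_add_indicatorFun_of_notMem _ hwC]
      exact le_top
  exact ⟨hreg.1, hreg.2.1, fun _ => x, fun _ => g + ξ, tendsto_const_nhds, tendsto_const_nhds,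
    tendsto_const_nhds, fun _ => hreg⟩

/-- A normal vector in the relative interior of the normal cone at `z` identifies the face: if
every normal cone of `C` near `z` is contained in that at `z`, then points of `C` near `z` having a
normal vector close to `v` are orthogonal to `normalCone C z`, relative to `z`. -/
theorem eventually_inner_sub_eq_zero {z v : E n}
    (hsub : ∀ᶠ y in 𝓝 z, normalCone C y ⊆ normalCone C z)
    (hv : v ∈ intrinsicInterior ℝ (normalCone C z)) :
    ∀ᶠ q : E n × E n in 𝓝 v ×ˢ 𝓝 z, q.1 ∈ normalCone C q.2 →
      ∀ ξ ∈ normalCone C z, inner ℝ ξ (q.2 - z) = 0 := by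
  obtain ⟨v0, hv0, rfl⟩ := hv
  have hz : z ∈ C := (show (v0 : E n) ∈ normalCone C z from
    interior_subset (s := Subtype.val ⁻¹' normalCone C z) hv0).1
  obtain ⟨V, hV, hVsub⟩ := (mem_nhds_subtype _ _ _).1 (isOpen_interior.mem_nhds hv0)
  have hnear : ∀ᶠ q : E n × E n in 𝓝 (v0 : E n) ×ˢ 𝓝 z, q.1 ∈ interior V ∧
      normalCone C q.2 ⊆ normalCone C z :=
    (eventually_of_mem (isOpen_interior.mem_nhds (mem_interior_iff_mem_nhds.2 hV))
      fun _ h => h).prod_mk hsub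
  filter_upwards [hnear] with q ⟨hq1, hq2⟩ hq ξ hξ
  have hqz := hq2 hq
  -- `q.1` is normal both at `q.2` and at `z`; testing each point against the other gives the two
  -- signs.
  have h0 : inner ℝ q.1 (q.2 - z) = 0 := by
    have h1 := hq.2 z hz
    have h2 := hqz.2 q.2 hq.1
    rw [← neg_sub, inner_neg_right] at h1
    linarith
  have hcont : Tendsto (fun ε : ℝ => q.1 + ε • (q.1 - ξ)) (𝓝[>] 0) (𝓝 q.1) := by
    have : Tendsto (fun ε : ℝ => q.1 + ε • (q.1 - ξ)) (𝓝 0) (𝓝 (q.1 + (0 : ℝ) • (q.1 - ξ))) :=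
      (hasDerivAt_add_smul q.1 (q.1 - ξ) 0).continuousAt
    simp only [zero_smul, add_zero] at this
    exact this.mono_left nhdsWithin_le_nhds
  obtain ⟨ε, hε, hε0⟩ := ((hcont.eventually (isOpen_interior.mem_nhds hq1)).and
    self_mem_nhdsWithin).exists
  -- Moving slightly beyond `q.1`, away from `ξ`, stays in the affine span, hence in the cone
  -- because `q.1` is near a relative interior point. Since `q.1` annihilates `q.2 - z`, this forces
  -- ⟨ξ, q.2 - z⟩ ≥ 0.
  have hmem : q.1 + ε • (q.1 - ξ) ∈ affineSpan ℝ (normalCone C z) := by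
    have := AffineMap.lineMap_mem (k := ℝ) (-ε) (mem_affineSpan ℝ hqz) (mem_affineSpan ℝ hξ)
    convert this using 1
    rw [AffineMap.lineMap_apply]
    simp only [vsub_eq_sub, vadd_eq_add, neg_smul]
    rw [← smul_neg, neg_sub, add_comm]
  have hN : q.1 + ε • (q.1 - ξ) ∈ normalCone C z :=
    interior_subset (s := Subtype.val ⁻¹' normalCone C z)
      (hVsub (show (⟨_, hmem⟩ : affineSpan ℝ (normalCone C z)) ∈ Subtype.val ⁻¹' V
        from interior_subset (s := V) hε))
  have h1 := hN.2 q.2 hq.1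
  rw [inner_add_left, inner_smul_left, inner_sub_left, h0] at h1
  have h2 := hξ.2 q.2 hq.1
  have h3 : 0 < ε := hε0
  simp at h1
  nlinarith

end Subdifferential

/-! ### From local to global along a sequence in a compact set -/

/-- If `p` failed infinitely often, the failing iterates would accumulate at some `z` by
compactness. The filter `atTop ⊓ comap x (𝓝 z)` describes large indices whose iterate is near `z`,
and replaces the extraction of subsequences. -/
theorem eventually_of_forall_comap_nhds {α : Type*} [TopologicalSpace α] {x : ℕ → α} {S : Set α}
    (hS : IsCompact S) (hx : ∀ᶠ k in atTop, x k ∈ S) {p : ℕ → Prop}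
    (h : ∀ z, MapClusterPt z atTop x → ∀ᶠ k in atTop ⊓ comap x (𝓝 z), p k) :
    ∀ᶠ k in atTop, p k := by
  by_contra hcon
  have hne : NeBot (atTop ⊓ 𝓟 {k | ¬ p k}) := by
    rw [← frequently_mem_iff_neBot]
    simpa [Filter.Frequently] using hcon
  have hle : map x (atTop ⊓ 𝓟 {k | ¬ p k}) ≤ 𝓟 S :=
    le_principal_iff.2 (mem_map.2 (mem_of_superset (mem_inf_of_left hx) fun _ h => h))
  obtain ⟨z, -, hz⟩ := hS hle
  have hz1 : MapClusterPt z atTop x := ClusterPt.mono hz (map_mono inf_le_left)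
  have hz2 : NeBot ((atTop ⊓ 𝓟 {k | ¬ p k}) ⊓ comap x (𝓝 z)) := by
    rw [neBot_inf_comap_iff_map, inf_comm]
    exact hz
  have h4 := h z hz1
  have h5 : ∀ᶠ k in (atTop ⊓ 𝓟 {k | ¬ p k}) ⊓ comap x (𝓝 z), p k ∧ ¬ p k :=
    (h4.filter_mono (inf_le_inf_right _ inf_le_left)).and
      (mem_inf_of_left (mem_inf_of_right (mem_principal_self _)))
  obtain ⟨k, hk, hk'⟩ := h5.exists
  exact hk' hk

theorem tendsto_comap_nhds {α : Type*} [TopologicalSpace α] (x : ℕ → α) (z : α) :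
    Tendsto x (atTop ⊓ comap x (𝓝 z)) (𝓝 z) :=
  tendsto_comap.mono_left inf_le_right

/-! ### Quadratic forms of matrices -/

section Matrices

variable {n : ℕ}

open Matrix in
theorem inner_toEuclideanLin (G : Matrix (Fin n) (Fin n) ℝ) (u v : E n) :
    inner ℝ u (Matrix.toEuclideanLin G v) = u.ofLp ⬝ᵥ G *ᵥ v.ofLp := by
  rw [EuclideanSpace.inner_eq_star_dotProduct, dotProduct_comm]
  simp

open Matrix in
theorem inner_toEuclideanLin_comm {G : Matrix (Fin n) (Fin n) ℝ} (hG : G.IsHermitian) (u v : E n) :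
    inner ℝ u (Matrix.toEuclideanLin G v) = inner ℝ v (Matrix.toEuclideanLin G u) := by
  have hT : Gᵀ = G := by simpa [Matrix.IsHermitian, conjTranspose_eq_transpose_of_trivial] using hG
  rw [inner_toEuclideanLin, inner_toEuclideanLin, dotProduct_mulVec, ← mulVec_transpose, hT,
    dotProduct_comm]

theorem posSemidef_of_inner_nonneg {G : Matrix (Fin n) (Fin n) ℝ} (hG : G.IsHermitian)
    (h : ∀ v : E n, 0 ≤ inner ℝ v (Matrix.toEuclideanLin G v)) : G.PosSemidef := by
  refine Matrix.PosSemidef.of_dotProduct_mulVec_nonneg hG fun v => ?_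
  have := h (WithLp.toLp 2 v)
  rw [inner_toEuclideanLin] at this
  simpa using this

theorem inner_nonneg_of_posSemidef {G : Matrix (Fin n) (Fin n) ℝ} (hG : G.PosSemidef) (v : E n) :
    0 ≤ inner ℝ v (Matrix.toEuclideanLin G v) := by
  rw [inner_toEuclideanLin]
  simpa using hG.dotProduct_mulVec_nonneg v.ofLp

theorem inner_toEuclideanLin_add (G H : Matrix (Fin n) (Fin n) ℝ) (u v : E n) :
    inner ℝ u (Matrix.toEuclideanLin (G + H) v) =
      inner ℝ u (Matrix.toEuclideanLin G v) + inner ℝ u (Matrix.toEuclideanLin H v) := by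
  rw [map_add, LinearMap.add_apply, inner_add_right]

theorem inner_toEuclideanLin_smul (c : ℝ) (G : Matrix (Fin n) (Fin n) ℝ) (u v : E n) :
    inner ℝ u (Matrix.toEuclideanLin (c • G) v) =
      c * inner ℝ u (Matrix.toEuclideanLin G v) := by
  rw [map_smul, LinearMap.smul_apply, inner_smul_right]

theorem inner_toEuclideanLin_one (v : E n) :
    inner ℝ v (Matrix.toEuclideanLin (1 : Matrix (Fin n) (Fin n) ℝ) v) = ‖v‖ ^ 2 := by
  rw [Matrix.toLpLin_one, LinearMap.id_apply, real_inner_self_eq_norm_sq]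

theorem isHermitian_smul_one (c : ℝ) : (c • (1 : Matrix (Fin n) (Fin n) ℝ)).IsHermitian := by
  simp [Matrix.IsHermitian]

theorem mem_spectrum_sub_smul_one {H : Matrix (Fin n) (Fin n) ℝ} {c a : ℝ} :
    a ∈ spectrum ℝ (H + (-c) • (1 : Matrix (Fin n) (Fin n) ℝ)) ↔ a + c ∈ spectrum ℝ H := by
  rw [spectrum.add_mem_iff, Algebra.algebraMap_eq_smul_one, add_comm, neg_smul]

theorem lambdaMin_mul_norm_sq_le {H : Matrix (Fin n) (Fin n) ℝ} (hH : H.IsHermitian) (v : E n) :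
    lambdaMin H * ‖v‖ ^ 2 ≤ inner ℝ v (Matrix.toEuclideanLin H v) := by
  have hpos : (H + (-lambdaMin H) • (1 : Matrix (Fin n) (Fin n) ℝ)).PosSemidef := by
    refine Matrix.posSemidef_iff_isHermitian_and_spectrum_nonneg.2
      ⟨hH.add (isHermitian_smul_one _), fun a ha => ?_⟩
    rw [mem_spectrum_sub_smul_one] at ha
    have : lambdaMin H ≤ a + lambdaMin H := csInf_le (Matrix.finite_spectrum H).bddBelow ha
    simpa using this
  have := inner_nonneg_of_posSemidef hpos v
  rw [inner_toEuclideanLin_add, inner_toEuclideanLin_smul, inner_toEuclideanLin_one] at this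
  linarith

theorem neg_lambdaMin_le {H : Matrix (Fin n) (Fin n) ℝ} (hH : H.IsHermitian) {L : ℝ} (hL : 0 ≤ L)
    (h : ∀ v : E n, -L * ‖v‖ ^ 2 ≤ inner ℝ v (Matrix.toEuclideanLin H v)) : -lambdaMin H ≤ L := by
  have hpos : (H + (-(-L)) • (1 : Matrix (Fin n) (Fin n) ℝ)).PosSemidef := by
    refine posSemidef_of_inner_nonneg (hH.add (isHermitian_smul_one _)) fun v => ?_
    rw [inner_toEuclideanLin_add, inner_toEuclideanLin_smul, inner_toEuclideanLin_one]
    linarith [h v]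
  rw [neg_le]
  rcases (spectrum ℝ H).eq_empty_or_nonempty with he | hne
  -- Empty spectrum (dimension zero): `sInf ∅ = 0`, and `0 ≤ L` settles the case.
  · rw [lambdaMin, he, Real.sInf_empty]
    linarith
  · refine le_csInf hne fun a ha => ?_
    have := (Matrix.posSemidef_iff_isHermitian_and_spectrum_nonneg.1 hpos).2
      (mem_spectrum_sub_smul_one.2 (show (a + L) + -L ∈ spectrum ℝ H by simpa using ha))
    have : 0 ≤ a + L := this
    linarith

/-- Expand the nonnegative form at v - M⁻¹Gv: the upper bound applied to v and to Gv leaves M⁻¹‖Gv‖²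
≤ M‖v‖². -/
theorem norm_toEuclideanLin_le {G : Matrix (Fin n) (Fin n) ℝ} (hG : G.IsHermitian) {M : ℝ}
    (hM : 0 < M) (h0 : ∀ v : E n, 0 ≤ inner ℝ v (Matrix.toEuclideanLin G v))
    (h1 : ∀ v : E n, inner ℝ v (Matrix.toEuclideanLin G v) ≤ M * ‖v‖ ^ 2) (v : E n) :
    ‖Matrix.toEuclideanLin G v‖ ≤ M * ‖v‖ := by
  set u := Matrix.toEuclideanLin G v with hu
  have h2 := h0 (v - M⁻¹ • u)
  have hc := inner_toEuclideanLin_comm hG v u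
  rw [map_sub, map_smul, inner_sub_left, inner_sub_right, inner_sub_right, inner_smul_left,
    inner_smul_left, inner_smul_right, inner_smul_right, hc, ← hu, real_inner_self_eq_norm_sq] at h2
  simp only [conj_trivial] at h2
  have h3 := h1 v
  rw [← hu] at h3
  have h4 := h1 u
  have h5 : M⁻¹ * (M⁻¹ * inner ℝ u (Matrix.toEuclideanLin G u)) ≤ M⁻¹ * ‖u‖ ^ 2 := by
    have : M⁻¹ * inner ℝ u (Matrix.toEuclideanLin G u) ≤ ‖u‖ ^ 2 := by
      rw [inv_mul_le_iff₀ hM]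
      exact h4
    exact mul_le_mul_of_nonneg_left this (inv_nonneg.2 hM.le)
  have h6 : M⁻¹ * ‖u‖ ^ 2 ≤ M * ‖v‖ ^ 2 := by linarith
  rw [inv_mul_le_iff₀ hM] at h6
  exact abs_le_of_sq_le_sq' (by nlinarith) (by positivity) |>.2

end Matrices

/-! ### The Hessian matrix -/

section Hessian

variable {n : ℕ} {f : E n → ℝ}

open Matrix in
theorem inner_hessMatrix (x u v : E n) :
    inner ℝ u (Matrix.toEuclideanLin (hessMatrix f x) v) = hess f x u v := by
  have hexp : ∀ w : E n, w = ∑ i, w i • EuclideanSpace.single i (1 : ℝ) := fun w => by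
    simpa using ((EuclideanSpace.basisFun (Fin n) ℝ).sum_repr w).symm
  rw [inner_toEuclideanLin]
  conv_rhs => rw [hexp u, hexp v]
  simp only [map_sum, map_smul, _root_.sum_apply, _root_.smul_apply,
    dotProduct, mulVec, hessMatrix, of_apply, smul_eq_mul, Finset.mul_sum]
  rw [Finset.sum_comm]
  refine Finset.sum_congr rfl fun i _ => Finset.sum_congr rfl fun j _ => ?_
  ring

theorem hess_comm (hf : ContDiff ℝ 2 f) (x u v : E n) : hess f x u v = hess f x v u :=
  (hf.contDiffAt.isSymmSndFDerivAt (by simp)).eq u v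

theorem isHermitian_hessMatrix (hf : ContDiff ℝ 2 f) (x : E n) : (hessMatrix f x).IsHermitian := by
  ext i j
  simpa [hessMatrix] using hess_comm hf x _ _

/-- Both sides are second derivatives at 0 of t ↦ f(x + tv), computed in two ways. -/
theorem SepRepr.hess_eq (S : SepRepr f) (hf : ContDiff ℝ 2 f) (x v : E n) :
    hess f x v v = ∑ i, S.hessDiag x i * (S.A.mulVec v.ofLp i) ^ 2 := by
  set c : Fin S.m → ℝ := S.A.mulVec x.ofLp - S.b with hc
  set a : Fin S.m → ℝ := S.A.mulVec v.ofLp with ha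
  have hline : ∀ t : ℝ, f (x + t • v) = ∑ i, S.h i (c i + a i * t) := fun t => by
    rw [S.f_eq]
    refine Finset.sum_congr rfl fun i _ => ?_
    congr 1
    simp only [hc, ha, WithLp.ofLp_add, WithLp.ofLp_smul, Matrix.mulVec_add, Matrix.mulVec_smul,
      Pi.sub_apply, Pi.add_apply, Pi.smul_apply, smul_eq_mul]
    ring
  have hlin : ∀ i (t : ℝ), HasDerivAt (fun s => c i + a i * s) (a i) t := fun i t => by
    simpa using ((hasDerivAt_id t).const_mul (a i)).const_add (c i)
  have hd1 : ∀ t : ℝ, fderiv ℝ f (x + t • v) v = ∑ i, deriv (S.h i) (c i + a i * t) * a i := by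
    intro t
    have h1 := hasDerivAt_line hf x v t
    have h2 : HasDerivAt (fun s : ℝ => ∑ i, S.h i (c i + a i * s))
        (∑ i, deriv (S.h i) (c i + a i * t) * a i) t :=
      HasDerivAt.fun_sum fun i _ =>
        (((S.contDiff_h i).differentiable (by norm_num)) _).hasDerivAt.comp t (hlin i t)
    exact h1.unique (h2.congr_of_eventuallyEq (Eventually.of_forall hline))
  have h1 := hasDerivAt_fderiv_line hf x v 0
  have h2 : HasDerivAt (fun s : ℝ => ∑ i, deriv (S.h i) (c i + a i * s) * a i)
      (∑ i, deriv (deriv (S.h i)) (c i + a i * 0) * a i * a i) 0 :=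
    HasDerivAt.fun_sum fun i _ =>
      (((((contDiff_succ_iff_deriv (n := 1)).1 (S.contDiff_h i)).2.2.differentiable
        (by norm_num)) _).hasDerivAt.comp (0 : ℝ) (hlin i 0)).mul_const (a i)
  have h3 := h1.unique (h2.congr_of_eventuallyEq (Eventually.of_forall hd1))
  simp only [zero_smul, add_zero, mul_zero] at h3
  rw [h3]
  refine Finset.sum_congr rfl fun i _ => ?_
  rw [SepRepr.hessDiag, iteratedDeriv_succ, iteratedDeriv_one]
  ring

theorem SepRepr.continuous_hessDiag (S : SepRepr f) (i : Fin S.m) :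
    Continuous fun x : E n => S.hessDiag x i := by
  have h1 := (S.contDiff_h i).continuous_iteratedDeriv 2 le_rfl
  refine h1.comp ?_
  have h2 : Continuous fun x : E n => S.A.mulVec x.ofLp :=
    Continuous.matrix_mulVec continuous_const (PiLp.continuous_ofLp 2 _)
  exact (continuous_apply i).comp (h2.sub continuous_const)

end Hessian

/-! ### The matrices of the quadratic models -/

section Models

variable {n : ℕ} {f : E n → ℝ}

/-- The properties of the model matrices at `x` used in the analysis: `G` is symmetric, of norm at
most `M`, and both `G` and `G - ∇²f(x)` are bounded below by `κ I`. -/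
structure IsModelMatrix (f : E n → ℝ) (x : E n) (κ M : ℝ) (G : Matrix (Fin n) (Fin n) ℝ) :
    Prop where
  isHermitian : G.IsHermitian
  norm_le : ∀ v : E n, ‖Matrix.toEuclideanLin G v‖ ≤ M * ‖v‖
  le_inner : ∀ v : E n, κ * ‖v‖ ^ 2 ≤ inner ℝ v (Matrix.toEuclideanLin G v)
  hess_add_le_inner : ∀ v : E n,
    hess f x v v + κ * ‖v‖ ^ 2 ≤ inner ℝ v (Matrix.toEuclideanLin G v)

theorem exists_mulVec_sq_le {m : ℕ} (A : Matrix (Fin m) (Fin n) ℝ) :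
    ∃ a, 0 ≤ a ∧ ∀ v : E n, ∑ i, A.mulVec v.ofLp i ^ 2 ≤ a * ‖v‖ ^ 2 := by
  let T := LinearMap.toContinuousLinearMap (Matrix.toEuclideanLin A)
  refine ⟨‖T‖ ^ 2, by positivity, fun v => ?_⟩
  have h1 := T.le_opNorm v
  have h2 : ‖T v‖ ^ 2 = ∑ i, A.mulVec v.ofLp i ^ 2 := by
    rw [EuclideanSpace.real_norm_sq_eq]
    rfl
  rw [← h2, ← mul_pow]
  gcongr

open Matrix in
theorem inner_transpose_mul_self {m : ℕ} (A : Matrix (Fin m) (Fin n) ℝ) (v : E n) :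
    inner ℝ v (Matrix.toEuclideanLin (Aᵀ * A) v) = ∑ i, A.mulVec v.ofLp i ^ 2 := by
  rw [inner_toEuclideanLin, ← mulVec_mulVec, dotProduct_mulVec, vecMul_transpose, dotProduct]
  exact Finset.sum_congr rfl fun i _ => (sq _).symm

open Matrix in
theorem inner_transpose_mul_diagonal_mul {m : ℕ} (A : Matrix (Fin m) (Fin n) ℝ) (D : Fin m → ℝ)
    (v : E n) :
    inner ℝ v (Matrix.toEuclideanLin (Aᵀ * diagonal D * A) v)
      = ∑ i, D i * A.mulVec v.ofLp i ^ 2 := by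
  rw [inner_toEuclideanLin, ← mulVec_mulVec, ← mulVec_mulVec, dotProduct_mulVec, vecMul_transpose,
    dotProduct]
  refine Finset.sum_congr rfl fun i _ => ?_
  rw [mulVec_diagonal]
  ring

theorem isModelMatrix_of_inner_le {x : E n} {κ M L : ℝ} {G : Matrix (Fin n) (Fin n) ℝ}
    (hG : G.IsHermitian) (hM : 0 < M) (hκ : 0 ≤ κ) (hL : L ≤ M)
    (h1 : ∀ v : E n, inner ℝ v (Matrix.toEuclideanLin G v) ≤ L * ‖v‖ ^ 2)
    (h2 : ∀ v : E n, κ * ‖v‖ ^ 2 ≤ inner ℝ v (Matrix.toEuclideanLin G v))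
    (h3 : ∀ v : E n, hess f x v v + κ * ‖v‖ ^ 2 ≤ inner ℝ v (Matrix.toEuclideanLin G v)) :
    IsModelMatrix f x κ M G :=
  ⟨hG, norm_toEuclideanLin_le hG hM (fun v => (by positivity : 0 ≤ κ * ‖v‖ ^ 2).trans (h2 v))
    fun v => (h1 v).trans (by gcongr), h2, h3⟩

/-- As `b₂ ≥ 1`, the shift by b₂[-λ_min]₊ cancels all negative curvature of ∇²f, leaving b₁r^σ as
lower bound. -/
theorem isModelMatrix_G₃ (hf : ContDiff ℝ 2 f) (θ : Params) {x : E n} {r rmax L M : ℝ}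
    (hr : 0 ≤ r) (hr' : r ≤ rmax) (hL : 0 ≤ L) (hfL : ‖hess f x‖ ≤ L)
    (hM : L + θ.b₂ * L + θ.b₁ * rmax ^ θ.σ < M) :
    IsModelMatrix f x (θ.b₁ * r ^ θ.σ) M (G₃ f θ x r) := by
  have hb₁ := θ.b₁_pos
  have hb₂ := θ.one_le_b₂
  have hrσ : r ^ θ.σ ≤ rmax ^ θ.σ := Real.rpow_le_rpow hr hr' θ.σ_mem.1.le
  have hrσ0 : 0 ≤ r ^ θ.σ := Real.rpow_nonneg hr _
  have hH := isHermitian_hessMatrix hf x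
  have hκ : 0 ≤ θ.b₁ * r ^ θ.σ := by positivity
  have hκ' : θ.b₁ * r ^ θ.σ ≤ θ.b₁ * rmax ^ θ.σ := by gcongr
  have hq : ∀ v : E n, inner ℝ v (Matrix.toEuclideanLin (G₃ f θ x r) v) =
      hess f x v v + (θ.b₂ * max (-lambdaMin (hessMatrix f x)) 0 + θ.b₁ * r ^ θ.σ) * ‖v‖ ^ 2 := by
    intro v
    rw [G₃, inner_toEuclideanLin_add, inner_toEuclideanLin_smul, inner_toEuclideanLin_one,
      inner_hessMatrix]
  have hlow : ∀ v : E n, -L * ‖v‖ ^ 2 ≤ hess f x v v := fun v => by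
    have h1 := (hess f x).le_opNorm₂ v v
    rw [Real.norm_eq_abs] at h1
    have h2 := (abs_le.1 h1).1
    nlinarith [mul_le_mul_of_nonneg_right hfL (sq_nonneg ‖v‖)]
  have hneg : max (-lambdaMin (hessMatrix f x)) 0 ≤ L :=
    max_le (neg_lambdaMin_le hH hL fun v => by rw [inner_hessMatrix]; exact hlow v) hL
  set s := max (-lambdaMin (hessMatrix f x)) 0 with hs
  have hs0 : 0 ≤ s := le_max_right _ _
  have hs1 : -lambdaMin (hessMatrix f x) ≤ s := le_max_left _ _
  have hb₂s : θ.b₂ * s ≤ θ.b₂ * L := by gcongr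
  refine isModelMatrix_of_inner_le (hH.add (isHermitian_smul_one _)) ?_ hκ hM.le ?_ ?_ ?_
  · have : 0 ≤ θ.b₂ * L := by positivity
    linarith
  · intro v
    rw [hq]
    have := hess_self_le_of_norm_le (d := v) hfL
    have h2 : (θ.b₂ * s + θ.b₁ * r ^ θ.σ) * ‖v‖ ^ 2 ≤
        (θ.b₂ * L + θ.b₁ * rmax ^ θ.σ) * ‖v‖ ^ 2 := by gcongr
    linarith
  · intro v
    rw [hq]
    have h1 := lambdaMin_mul_norm_sq_le hH v
    rw [inner_hessMatrix] at h1
    have h2 : -lambdaMin (hessMatrix f x) * ‖v‖ ^ 2 ≤ θ.b₂ * s * ‖v‖ ^ 2 := by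
      gcongr
      nlinarith
    linarith
  · intro v
    rw [hq]
    have : 0 ≤ θ.b₂ * s * ‖v‖ ^ 2 := by positivity
    linarith

/-- With ∇²f = AᵀDA, adding b₂[-λ_min(D)]₊AᵀA makes every diagonal weight nonnegative, again because
`b₂ ≥ 1`. -/
theorem isModelMatrix_G₁ (hf : ContDiff ℝ 2 f) (θ : Params) (S : SepRepr f) {x : E n}
    {r rmax L M D a : ℝ} (hr : 0 ≤ r) (hr' : r ≤ rmax) (hL : 0 ≤ L) (hfL : ‖hess f x‖ ≤ L)
    (hD : 0 ≤ D) (hSD : ∀ i, |S.hessDiag x i| ≤ D) (ha : 0 ≤ a)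
    (hAa : ∀ v : E n, ∑ i, S.A.mulVec v.ofLp i ^ 2 ≤ a * ‖v‖ ^ 2)
    (hM : L + θ.b₂ * D * a + θ.b₁ * rmax ^ θ.σ < M) :
    IsModelMatrix f x (θ.b₁ * r ^ θ.σ) M (G₁ θ S x r) := by
  have hb₁ := θ.b₁_pos
  have hb₂ := θ.one_le_b₂
  have hrσ : r ^ θ.σ ≤ rmax ^ θ.σ := Real.rpow_le_rpow hr hr' θ.σ_mem.1.le
  have hrσ0 : 0 ≤ r ^ θ.σ := Real.rpow_nonneg hr _
  have hκ : 0 ≤ θ.b₁ * r ^ θ.σ := by positivity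
  have hκ' : θ.b₁ * r ^ θ.σ ≤ θ.b₁ * rmax ^ θ.σ := by gcongr
  have hq : ∀ v : E n, inner ℝ v (Matrix.toEuclideanLin (G₁ θ S x r) v) =
      hess f x v v + θ.b₂ * max (-lambdaMin (Matrix.diagonal (S.hessDiag x))) 0 *
        (∑ i, S.A.mulVec v.ofLp i ^ 2) + θ.b₁ * r ^ θ.σ * ‖v‖ ^ 2 := by
    intro v
    rw [G₁, inner_toEuclideanLin_add, inner_toEuclideanLin_smul, inner_toEuclideanLin_one,
      inner_toEuclideanLin_add, inner_toEuclideanLin_smul, inner_hessMatrix,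
      inner_transpose_mul_self]
  have hspec : spectrum ℝ (Matrix.diagonal (S.hessDiag x)) = range (S.hessDiag x) :=
    spectrum_diagonal _
  have hmin : ∀ i, lambdaMin (Matrix.diagonal (S.hessDiag x)) ≤ S.hessDiag x i := fun i => by
    rw [lambdaMin, hspec]
    exact csInf_le (finite_range _).bddBelow (mem_range_self i)
  have hneg : max (-lambdaMin (Matrix.diagonal (S.hessDiag x))) 0 ≤ D := by
    refine max_le ?_ hD
    rw [neg_le, lambdaMin, hspec]
    rcases (range (S.hessDiag x)).eq_empty_or_nonempty with he | hne
    · rw [he, Real.sInf_empty]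
      linarith
    · refine le_csInf hne ?_
      rintro _ ⟨i, rfl⟩
      exact (abs_le.1 (hSD i)).1
  set s := max (-lambdaMin (Matrix.diagonal (S.hessDiag x))) 0 with hs
  have hs0 : 0 ≤ s := le_max_right _ _
  have hs1 : -lambdaMin (Matrix.diagonal (S.hessDiag x)) ≤ s := le_max_left _ _
  have hATA : (S.A.transpose * S.A).IsHermitian := by
    simp [Matrix.IsHermitian]
  have hsq0 : ∀ v : E n, 0 ≤ ∑ i, S.A.mulVec v.ofLp i ^ 2 := fun v =>
    Finset.sum_nonneg fun i _ => sq_nonneg _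
  refine isModelMatrix_of_inner_le (((isHermitian_hessMatrix hf x).add ?_).add
    (isHermitian_smul_one _)) ?_ hκ hM.le ?_ ?_ ?_
  · rw [Matrix.IsHermitian, Matrix.conjTranspose_smul, hATA.eq, star_trivial]
  · have : 0 ≤ θ.b₂ * D * a := by positivity
    linarith
  · intro v
    rw [hq]
    have h1 := hess_self_le_of_norm_le (d := v) hfL
    have h2 : θ.b₂ * s * ∑ i, S.A.mulVec v.ofLp i ^ 2 ≤ θ.b₂ * D * (a * ‖v‖ ^ 2) :=
      mul_le_mul (by gcongr) (hAa v) (hsq0 v) (by positivity)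
    have h3 : θ.b₁ * r ^ θ.σ * ‖v‖ ^ 2 ≤ θ.b₁ * rmax ^ θ.σ * ‖v‖ ^ 2 := by gcongr
    linarith
  · intro v
    rw [hq, S.hess_eq hf, Finset.mul_sum, ← Finset.sum_add_distrib]
    have : 0 ≤ ∑ i, (S.hessDiag x i * S.A.mulVec v.ofLp i ^ 2
        + θ.b₂ * s * S.A.mulVec v.ofLp i ^ 2) := by
      refine Finset.sum_nonneg fun i _ => ?_
      rw [← add_mul]
      refine mul_nonneg ?_ (sq_nonneg _)
      nlinarith [hmin i]
    linarith
  · intro v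
    rw [hq]
    have : 0 ≤ θ.b₂ * s * ∑ i, S.A.mulVec v.ofLp i ^ 2 := mul_nonneg (by positivity) (hsq0 v)
    linarith

/-- Replacing D by its positive part in ∇²f = AᵀDA can only raise the quadratic form. -/
theorem isModelMatrix_G₂ (hf : ContDiff ℝ 2 f) (θ : Params) (S : SepRepr f) {x : E n}
    {r rmax M D a : ℝ} (hr : 0 ≤ r) (hr' : r ≤ rmax)
    (hD : 0 ≤ D) (hSD : ∀ i, |S.hessDiag x i| ≤ D) (ha : 0 ≤ a)
    (hAa : ∀ v : E n, ∑ i, S.A.mulVec v.ofLp i ^ 2 ≤ a * ‖v‖ ^ 2)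
    (hM : D * a + θ.b₁ * rmax ^ θ.σ < M) :
    IsModelMatrix f x (θ.b₁ * r ^ θ.σ) M (G₂ θ S x r) := by
  have hb₁ := θ.b₁_pos
  have hrσ : r ^ θ.σ ≤ rmax ^ θ.σ := Real.rpow_le_rpow hr hr' θ.σ_mem.1.le
  have hrσ0 : 0 ≤ r ^ θ.σ := Real.rpow_nonneg hr _
  have hκ : 0 ≤ θ.b₁ * r ^ θ.σ := by positivity
  have hκ' : θ.b₁ * r ^ θ.σ ≤ θ.b₁ * rmax ^ θ.σ := by gcongr
  have hq : ∀ v : E n, inner ℝ v (Matrix.toEuclideanLin (G₂ θ S x r) v) =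
      (∑ i, max (S.hessDiag x i) 0 * S.A.mulVec v.ofLp i ^ 2) + θ.b₁ * r ^ θ.σ * ‖v‖ ^ 2 := by
    intro v
    rw [G₂, inner_toEuclideanLin_add, inner_toEuclideanLin_smul, inner_toEuclideanLin_one,
      inner_transpose_mul_diagonal_mul]
  refine isModelMatrix_of_inner_le (Matrix.IsHermitian.add ?_ (isHermitian_smul_one _)) ?_ hκ hM.le
    ?_ ?_ ?_
  · simp [Matrix.IsHermitian, Matrix.mul_assoc]
  · have : 0 ≤ D * a := by positivity
    linarith
  · intro v
    rw [hq]
    have h1 : ∑ i, max (S.hessDiag x i) 0 * S.A.mulVec v.ofLp i ^ 2 ≤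
        D * ∑ i, S.A.mulVec v.ofLp i ^ 2 := by
      rw [Finset.mul_sum]
      exact Finset.sum_le_sum fun i _ => mul_le_mul_of_nonneg_right
        (max_le ((le_abs_self _).trans (hSD i)) hD) (sq_nonneg _)
    have h2 := mul_le_mul_of_nonneg_left (hAa v) hD
    have h3 : θ.b₁ * r ^ θ.σ * ‖v‖ ^ 2 ≤ θ.b₁ * rmax ^ θ.σ * ‖v‖ ^ 2 := by gcongr
    linarith
  · intro v
    rw [hq]
    have : 0 ≤ ∑ i, max (S.hessDiag x i) 0 * S.A.mulVec v.ofLp i ^ 2 :=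
      Finset.sum_nonneg fun i _ => mul_nonneg (le_max_right _ _) (sq_nonneg _)
    linarith
  · intro v
    rw [hq, S.hess_eq hf]
    gcongr
    exact le_max_left _ _

theorem exists_hess_norm_le (hf : ContDiff ℝ 2 f) {K : Set (E n)} (hK : IsCompact K) :
    ∃ L, 0 < L ∧ ∀ x ∈ K, ‖hess f x‖ ≤ L := by
  obtain ⟨L, hL⟩ := hK.exists_bound_of_continuousOn (f := hess f)
    (continuous_hess_of_contDiff_two hf).continuousOn
  exact ⟨max L 1, by positivity, fun x hx => (hL x hx).trans (le_max_left _ _)⟩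

theorem exists_isModelMatrix_G₃ (hf : ContDiff ℝ 2 f) (θ : Params) {K : Set (E n)}
    (hK : IsCompact K) (rmax : ℝ) :
    ∃ M, ∀ x ∈ K, ∀ r, 0 ≤ r → r ≤ rmax →
      IsModelMatrix f x (θ.b₁ * r ^ θ.σ) M (G₃ f θ x r) := by
  obtain ⟨L, hL, hfL⟩ := exists_hess_norm_le hf hK
  exact ⟨L + θ.b₂ * L + θ.b₁ * rmax ^ θ.σ + 1, fun x hx r hr hr' =>
    isModelMatrix_G₃ hf θ hr hr' hL.le (hfL x hx) (lt_add_one _)⟩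

theorem IsModelMatrix.mono {x : E n} {κ M M' : ℝ} {G : Matrix (Fin n) (Fin n) ℝ}
    (h : IsModelMatrix f x κ M G) (hM : M ≤ M') : IsModelMatrix f x κ M' G :=
  ⟨h.isHermitian, fun v => (h.norm_le v).trans (by gcongr), h.le_inner, h.hess_add_le_inner⟩

theorem exists_isModelMatrix_sepRepr (hf : ContDiff ℝ 2 f) (θ : Params) (S : SepRepr f)
    {K : Set (E n)} (hK : IsCompact K) (rmax : ℝ) :
    ∃ M, ∀ x ∈ K, ∀ r, 0 ≤ r → r ≤ rmax →
      IsModelMatrix f x (θ.b₁ * r ^ θ.σ) M (G₁ θ S x r) ∧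
      IsModelMatrix f x (θ.b₁ * r ^ θ.σ) M (G₂ θ S x r) := by
  obtain ⟨L, hL, hfL⟩ := exists_hess_norm_le hf hK
  obtain ⟨D, hD⟩ := hK.exists_bound_of_continuousOn (f := fun x => S.hessDiag x)
    (continuous_pi S.continuous_hessDiag).continuousOn
  obtain ⟨a, ha, hAa⟩ := exists_mulVec_sq_le S.A
  have hD' : ∀ x ∈ K, ∀ i, |S.hessDiag x i| ≤ max D 0 := fun x hx i =>
    ((norm_le_pi_norm _ i).trans (hD x hx)).trans (le_max_left _ _)
  refine ⟨max (L + θ.b₂ * max D 0 * a + θ.b₁ * rmax ^ θ.σ + 1)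
    (max D 0 * a + θ.b₁ * rmax ^ θ.σ + 1), fun x hx r hr hr' => ⟨?_, ?_⟩⟩
  · exact (isModelMatrix_G₁ hf θ S hr hr' hL.le (hfL x hx) (le_max_right _ _) (hD' x hx) ha hAa
      (lt_add_one _)).mono (le_max_left _ _)
  · exact (isModelMatrix_G₂ hf θ S hr hr' (le_max_right _ _) (hD' x hx) ha hAa
      (lt_add_one _)).mono (le_max_right _ _)

end Models

namespace Problem

variable {n p : ℕ} (P : Problem n p)

/-! ### The box and the polytopes `Π(z)` -/

theorem isCompact_Ω : IsCompact P.Ω := by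
  have h : P.Ω = WithLp.toLp 2 '' Icc P.l P.u := by
    ext x
    constructor
    · exact fun hx => ⟨x.ofLp, ⟨fun i => (hx i).1, fun i => (hx i).2⟩, rfl⟩
    · rintro ⟨y, hy, rfl⟩
      exact fun i => ⟨hy.1 i, hy.2 i⟩
  rw [h]
  exact isCompact_Icc.image (PiLp.continuous_toLp 2 _)

theorem convex_Ω : Convex ℝ P.Ω := by
  intro x hx y hy a b ha hb hab i
  have h := (convex_Icc (P.l i) (P.u i)) (hx i) (hy i) ha hb hab
  exact h

theorem zero_mem_Ω : (0 : E n) ∈ P.Ω := fun i => ⟨P.l_nonpos i, P.u_nonneg i⟩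

theorem mem_Pi_iff {z x : E n} : x ∈ P.Pi z ↔ x ∈ P.Ω ∧ (∀ i, z i = 0 → x i = 0) ∧
    ∀ j, P.B.mulVec z.ofLp j = 0 → P.B.mulVec x.ofLp j = 0 := by
  simp only [Pi, mem_ofPred_eq, supp, suppB, Function.support_subset_iff, ne_eq,
    Function.mem_support, not_imp_not]

theorem mem_Pi_self {x : E n} (hx : x ∈ P.Ω) : x ∈ P.Pi x := ⟨hx, Subset.rfl, Subset.rfl⟩

theorem Pi_congr {x z : E n} (h : P.supp x = P.supp z) (hB : P.suppB x = P.suppB z) :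
    P.Pi x = P.Pi z := by
  simp only [Pi, h, hB]

theorem convex_Pi (z : E n) : Convex ℝ (P.Pi z) := by
  intro x hx y hy a b ha hb hab
  rw [mem_Pi_iff] at hx hy ⊢
  refine ⟨P.convex_Ω hx.1 hy.1 ha hb hab, fun i hi => ?_, fun j hj => ?_⟩
  · simp [hx.2.1 i hi, hy.2.1 i hi]
  · simp [Matrix.mulVec_add, Matrix.mulVec_smul, hx.2.2 j hj, hy.2.2 j hj]

theorem continuous_mulVec_apply (j : Fin p) : Continuous fun x : E n => P.B.mulVec x.ofLp j :=
  (continuous_apply j).comp (Continuous.matrix_mulVec continuous_const (PiLp.continuous_ofLp 2 _))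

theorem continuous_coord (i : Fin n) : Continuous fun x : E n => x i :=
  (continuous_apply i).comp (PiLp.continuous_ofLp 2 _)

theorem eventually_supp_subset (z : E n) :
    ∀ᶠ x in 𝓝 z, P.supp z ⊆ P.supp x ∧ P.suppB z ⊆ P.suppB x := by
  have h1 : ∀ i, ∀ᶠ x : E n in 𝓝 z, i ∈ P.supp z → i ∈ P.supp x := fun i => by
    by_cases hi : i ∈ P.supp z
    · filter_upwards [(continuous_coord i).continuousAt.eventually_ne hi] with x hx _ using hx
    · exact Eventually.of_forall fun _ h => absurd h hi
  have h2 : ∀ j, ∀ᶠ x : E n in 𝓝 z, j ∈ P.suppB z → j ∈ P.suppB x := fun j => by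
    by_cases hj : j ∈ P.suppB z
    · filter_upwards [(P.continuous_mulVec_apply j).continuousAt.eventually_ne hj] with x hx _
        using hx
    · exact Eventually.of_forall fun _ h => absurd h hj
  filter_upwards [eventually_all.2 h1, eventually_all.2 h2] with x hx1 hx2 using ⟨hx1, hx2⟩

/-- A bound active at `z` is respected by w - z itself. An inactive one has slack at `z`, more than
half of which survives at nearby `x`; hence the factor 1/2. Feasible directions at `z` are thus
feasible at `x`, which makes normals at `x` normals at `z`. -/
theorem eventually_half_step_mem_Pi {a z : E n} (hz : z ∈ P.Pi a) :
    ∀ᶠ x in 𝓝 z, x ∈ P.Pi a → ∀ w ∈ P.Pi a, x + (1 / 2 : ℝ) • (w - z) ∈ P.Pi a := by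
  have h1 : ∀ i, ∀ᶠ x : E n in 𝓝 z, z i ≠ P.l i → P.l i + 1 / 2 * (z i - P.l i) < x i :=
    fun i => by
      by_cases hi : z i = P.l i
      · exact Eventually.of_forall fun _ h => absurd hi h
      · have := (hz.1 i).1.lt_of_ne (Ne.symm hi)
        filter_upwards [(continuous_coord i).continuousAt.eventually_const_lt
          (show P.l i + 1 / 2 * (z i - P.l i) < z i by linarith)] with x hx _ using hx
  have h2 : ∀ i, ∀ᶠ x : E n in 𝓝 z, z i ≠ P.u i → x i < P.u i - 1 / 2 * (P.u i - z i) :=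
    fun i => by
      by_cases hi : z i = P.u i
      · exact Eventually.of_forall fun _ h => absurd hi h
      · have := (hz.1 i).2.lt_of_ne hi
        filter_upwards [(continuous_coord i).continuousAt.eventually_lt_const
          (show z i < P.u i - 1 / 2 * (P.u i - z i) by linarith)] with x hx _ using hx
  filter_upwards [eventually_all.2 h1, eventually_all.2 h2] with x hx1 hx2 hx w hw
  rw [mem_Pi_iff] at hx hw hz ⊢
  refine ⟨fun i => ?_, fun i hi => ?_, fun j hj => ?_⟩
  · have hxi := hx.1 i
    have hwi := hw.1 i
    have hzi := hz.1 i
    have e : (x + (1 / 2 : ℝ) • (w - z)) i = x i + 1 / 2 * (w i - z i) := rfl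
    rw [e]
    constructor
    · by_cases hi : z i = P.l i
      · linarith
      · linarith [hx1 i hi]
    · by_cases hi : z i = P.u i
      · linarith
      · linarith [hx2 i hi]
  · simp [hx.2.1 i hi, hw.2.1 i hi, hz.2.1 i hi]
  · simp [Matrix.mulVec_add, Matrix.mulVec_smul, Matrix.mulVec_sub, hx.2.2 j hj, hw.2.2 j hj,
      hz.2.2 j hj]

theorem eventually_normalCone_subset {a z : E n} (hz : z ∈ P.Pi a) :
    ∀ᶠ x in 𝓝 z, normalCone (P.Pi a) x ⊆ normalCone (P.Pi a) z := by
  filter_upwards [P.eventually_half_step_mem_Pi hz] with x hx ξ hξ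
  refine ⟨hz, fun w hw => ?_⟩
  have := hξ.2 _ (hx hξ.1 w hw)
  rw [add_sub_cancel_left, inner_smul_right] at this
  linarith

/-! ### The penalty -/

theorem pen_mono {x z : E n} (h : P.supp x ⊆ P.supp z) (hB : P.suppB x ⊆ P.suppB z) :
    P.pen x ≤ P.pen z := by
  have h1 : l0norm x.ofLp ≤ l0norm z.ofLp := ncard_le_ncard h (toFinite _)
  have h2 : l0norm (P.B.mulVec x.ofLp) ≤ l0norm (P.B.mulVec z.ofLp) :=
    ncard_le_ncard hB (toFinite _)
  have := P.lam₁_pos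
  have := P.lam₂_pos
  unfold pen
  gcongr

theorem pen_congr {x z : E n} (h : P.supp x = P.supp z) (hB : P.suppB x = P.suppB z) :
    P.pen x = P.pen z :=
  le_antisymm (P.pen_mono h.subset hB.subset) (P.pen_mono h.superset hB.superset)

/-- Each additional nonzero entry of x or of Bx costs at least min{λ₁, λ₂}. -/
theorem supp_eq_of_pen_lt {x z : E n} (h : P.supp z ⊆ P.supp x) (hB : P.suppB z ⊆ P.suppB x)
    (hlt : P.pen x < P.pen z + min P.lam₁ P.lam₂) :
    P.supp x = P.supp z ∧ P.suppB x = P.suppB z := by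
  have h1 : l0norm z.ofLp ≤ l0norm x.ofLp := ncard_le_ncard h (toFinite _)
  have h2 : l0norm (P.B.mulVec z.ofLp) ≤ l0norm (P.B.mulVec x.ofLp) :=
    ncard_le_ncard hB (toFinite _)
  have hl1 := P.lam₁_pos
  have hl2 := P.lam₂_pos
  unfold pen at hlt
  constructor
  · refine (eq_of_subset_of_ncard_le h ?_ (toFinite _)).symm
    change l0norm x.ofLp ≤ l0norm z.ofLp
    by_contra! hcon
    have h3 : (l0norm z.ofLp : ℝ) + 1 ≤ l0norm x.ofLp := by exact_mod_cast hcon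
    have h4 : (l0norm (P.B.mulVec z.ofLp) : ℝ) ≤ l0norm (P.B.mulVec x.ofLp) := by exact_mod_cast h2
    have := min_le_right P.lam₁ P.lam₂
    nlinarith
  · refine (eq_of_subset_of_ncard_le hB ?_ (toFinite _)).symm
    change l0norm (P.B.mulVec x.ofLp) ≤ l0norm (P.B.mulVec z.ofLp)
    by_contra! hcon
    have h3 : (l0norm (P.B.mulVec z.ofLp) : ℝ) + 1 ≤ l0norm (P.B.mulVec x.ofLp) := by
      exact_mod_cast hcon
    have h4 : (l0norm z.ofLp : ℝ) ≤ l0norm x.ofLp := by exact_mod_cast h1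
    have := min_le_left P.lam₁ P.lam₂
    nlinarith

/-! ### Proximal gradient points -/

theorem g_of_mem {x : E n} (hx : x ∈ P.Ω) : P.g x = P.pen x := coe_add_indicatorFun_of_mem _ hx

theorem g_of_notMem {x : E n} (hx : x ∉ P.Ω) : P.g x = ⊤ := coe_add_indicatorFun_of_notMem _ hx

theorem mem_pgPoints_iff {μ : ℝ} (hμ : 0 < μ) {x z : E n} :
    z ∈ P.pgPoints μ x ↔ z ∈ P.Ω ∧ ∀ w ∈ P.Ω,
      inner ℝ (gradient P.f x) (z - x) + μ / 2 * ‖z - x‖ ^ 2 + P.pen z ≤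
        inner ℝ (gradient P.f x) (w - x) + μ / 2 * ‖w - x‖ ^ 2 + P.pen w := by
  have hexp : ∀ w : E n, 1 / (2 * μ⁻¹) * ‖w - (x - μ⁻¹ • gradient P.f x)‖ ^ 2 =
      inner ℝ (gradient P.f x) (w - x) + μ / 2 * ‖w - x‖ ^ 2
        + μ⁻¹ / 2 * ‖gradient P.f x‖ ^ 2 := fun w => by
    rw [show w - (x - μ⁻¹ • gradient P.f x) = (w - x) + μ⁻¹ • gradient P.f x by abel,
      norm_add_sq_real, inner_smul_right, norm_smul, Real.norm_eq_abs, abs_of_pos (inv_pos.2 hμ),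
      real_inner_comm]
    field_simp
    ring
  constructor
  · intro h
    have hz : z ∈ P.Ω := by
      by_contra hz
      -- The origin is feasible, so it is a competitor with finite value.
      have h0 := h 0
      rw [P.g_of_notMem hz, EReal.coe_add_top, P.g_of_mem P.zero_mem_Ω, ← EReal.coe_add,
        top_le_iff] at h0
      exact EReal.coe_ne_top _ h0
    refine ⟨hz, fun w hw => ?_⟩
    have hw' := h w
    rw [P.g_of_mem hz, P.g_of_mem hw, ← EReal.coe_add, ← EReal.coe_add, EReal.coe_le_coe_iff,
      hexp, hexp] at hw'
    linarith
  · rintro ⟨hz, h⟩ w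
    by_cases hw : w ∈ P.Ω
    · rw [P.g_of_mem hz, P.g_of_mem hw, ← EReal.coe_add, ← EReal.coe_add, EReal.coe_le_coe_iff,
        hexp, hexp]
      linarith [h w hw]
    · rw [P.g_of_notMem hw, EReal.coe_add_top]
      exact le_top

/-- Once μ ≥ L + α, the quadratic term of the proximal inequality pays for both the Taylor remainder
and the required decrease; so backtracking must stop. -/
theorem F_le_of_mem_pgPoints {L α μ : ℝ} (hL : ∀ x ∈ P.Ω, ‖hess P.f x‖ ≤ L) (hμ : 0 < μ)
    (hLμ : L + α ≤ μ) {x z : E n} (hx : x ∈ P.Ω) (hz : z ∈ P.pgPoints μ x) :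
    P.F z ≤ P.F x - α / 2 * ‖x - z‖ ^ 2 := by
  obtain ⟨hzΩ, h⟩ := (P.mem_pgPoints_iff hμ).1 hz
  have h1 := h x hx
  have h2 := le_of_hess_norm_le P.contDiff_f P.convex_Ω hL (d := z - x) hx (by simpa using hzΩ)
  rw [add_sub_cancel] at h2
  simp only [sub_self, inner_zero_right, norm_zero] at h1
  rw [norm_sub_rev x z]
  unfold F
  nlinarith [sq_nonneg ‖z - x‖]

theorem mem_Pi_of_switch {x z : E n} (hz : z ∈ P.Ω) (hs : P.Switch x z) : z ∈ P.Pi x :=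
  ⟨hz, hs.1.superset, hs.2.superset⟩

/-- Within Π(x) the penalty cannot exceed its value at `z`, because `x` and `z` have equal supports.
So `z` minimizes the smooth quadratic part alone over the convex set Π(x), and this is its
first-order condition. -/
theorem neg_gradient_sub_mem_normalCone {μ : ℝ} (hμ : 0 < μ) {x z : E n}
    (hz : z ∈ P.pgPoints μ x) (hs : P.Switch x z) :
    -gradient P.f x - μ • (z - x) ∈ normalCone (P.Pi x) z := by
  obtain ⟨hzΩ, h⟩ := (P.mem_pgPoints_iff hμ).1 hz
  have hzPi := P.mem_Pi_of_switch hzΩ hs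
  refine ⟨hzPi, fun w hw => ?_⟩
  have key : ∀ t ∈ Ioo (0 : ℝ) 1, inner ℝ (-gradient P.f x - μ • (z - x)) (w - z) ≤
      t * (μ / 2 * ‖w - z‖ ^ 2) := by
    intro t ht
    have hmem : z + t • (w - z) ∈ P.Pi x :=
      (P.convex_Pi x).add_smul_sub_mem hzPi hw ⟨ht.1.le, ht.2.le⟩
    have h1 := h _ hmem.1
    have h2 : P.pen (z + t • (w - z)) ≤ P.pen z :=
      (P.pen_mono hmem.2.1 hmem.2.2).trans_eq (P.pen_congr hs.1 hs.2)
    rw [show z + t • (w - z) - x = (z - x) + t • (w - z) by abel, norm_add_sq_real,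
      inner_add_right, inner_smul_right, inner_smul_right, norm_smul, Real.norm_eq_abs,
      mul_pow, sq_abs] at h1
    rw [inner_sub_left, inner_neg_left, inner_smul_left, conj_trivial]
    have h3 : 0 ≤ t * (inner ℝ (gradient P.f x) (w - z) + μ * inner ℝ (z - x) (w - z)
      + t * (μ / 2 * ‖w - z‖ ^ 2)) := by nlinarith
    have := nonneg_of_mul_nonneg_right h3 ht.1
    linarith
  have hlim : Tendsto (fun t : ℝ => t * (μ / 2 * ‖w - z‖ ^ 2)) (𝓝[>] 0) (𝓝 0) := by
    have : Tendsto (fun t : ℝ => t * (μ / 2 * ‖w - z‖ ^ 2)) (𝓝 0)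
        (𝓝 (0 * (μ / 2 * ‖w - z‖ ^ 2))) := tendsto_id.mul_const _
    rw [zero_mul] at this
    exact this.mono_left nhdsWithin_le_nhds
  refine ge_of_tendsto hlim ?_
  filter_upwards [Ioo_mem_nhdsGT (zero_lt_one' ℝ)] with t ht using key t ht

section Limits

variable {l : Filter ℕ} {x xbar : ℕ → E n} {μ : ℕ → ℝ} {z : E n} {M : ℝ}

/-- Along proximal gradient points, the supports are those of the limit. -/
theorem eventually_supp_pgPoints_eq (hx : Tendsto x l (𝓝 z)) (hxbar : Tendsto xbar l (𝓝 z))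
    (hz : z ∈ P.Ω) (hμ : ∀ k, 0 < μ k) (hμM : ∀ k, μ k ≤ M)
    (hpg : ∀ k, xbar k ∈ P.pgPoints (μ k) (x k)) :
    ∀ᶠ k in l, P.supp (xbar k) = P.supp z ∧ P.suppB (xbar k) = P.suppB z := by
  have hg : Tendsto (fun k => gradient P.f (x k)) l (𝓝 (gradient P.f z)) :=
    ((continuous_gradient_of_contDiff_two P.contDiff_f).tendsto z).comp hx
  have hlim : Tendsto (fun k => inner ℝ (gradient P.f (x k)) (z - x k)
      - inner ℝ (gradient P.f (x k)) (xbar k - x k) + M / 2 * ‖z - x k‖ ^ 2 + P.pen z) l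
      (𝓝 (inner ℝ (gradient P.f z) (z - z) - inner ℝ (gradient P.f z) (z - z)
        + M / 2 * ‖z - z‖ ^ 2 + P.pen z)) :=
    (((hg.inner (tendsto_const_nhds.sub hx)).sub (hg.inner (hxbar.sub hx))).add
      (((tendsto_const_nhds.sub hx).norm.pow 2).const_mul _)).add_const _
  have hmin : 0 < min P.lam₁ P.lam₂ := lt_min P.lam₁_pos P.lam₂_pos
  have hlt := hlim.eventually_lt_const (u := P.pen z + min P.lam₁ P.lam₂) (by simpa using hmin)
  filter_upwards [hlt, hxbar.eventually (P.eventually_supp_subset z)] with k hk hsub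
  -- The competitor w = z in the proximal inequality gives pen(x̄ᵏ) ≤ pen(z) + o(1), while supports
  -- can only grow near `z`.
  refine P.supp_eq_of_pen_lt hsub.1 hsub.2 (lt_of_le_of_lt ?_ hk)
  have h1 := ((P.mem_pgPoints_iff (hμ k)).1 (hpg k)).2 z hz
  have h2 : 0 ≤ μ k / 2 * ‖xbar k - x k‖ ^ 2 := by have := (hμ k).le; positivity
  have h3 : μ k / 2 * ‖z - x k‖ ^ 2 ≤ M / 2 * ‖z - x k‖ ^ 2 := by
    have := hμM k
    gcongr
  linarith

/-- The upper bound `M` serves as the proximal parameter: the quadratic term on the left is dropped,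
that on the right is enlarged from μₖ to `M`. The discontinuous penalty is harmless since that of
x̄ᵏ is eventually pen(z). -/
theorem isLStationary_of_tendsto [NeBot l] (hx : Tendsto x l (𝓝 z)) (hxbar : Tendsto xbar l (𝓝 z))
    (hz : z ∈ P.Ω) (hμ : ∀ k, 0 < μ k) (hμM : ∀ k, μ k ≤ M)
    (hpg : ∀ k, xbar k ∈ P.pgPoints (μ k) (x k)) : P.IsLStationary z := by
  have hM : 0 < M := (hμ 0).trans_le (hμM 0)
  refine ⟨M, hM, (P.mem_pgPoints_iff hM).2 ⟨hz, fun w hw => ?_⟩⟩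
  have hg : Tendsto (fun k => gradient P.f (x k)) l (𝓝 (gradient P.f z)) :=
    ((continuous_gradient_of_contDiff_two P.contDiff_f).tendsto z).comp hx
  have hL : Tendsto (fun k => inner ℝ (gradient P.f (x k)) (xbar k - x k)) l
      (𝓝 (inner ℝ (gradient P.f z) (z - z))) := hg.inner (hxbar.sub hx)
  have hR : Tendsto (fun k => inner ℝ (gradient P.f (x k)) (w - x k) + M / 2 * ‖w - x k‖ ^ 2) l
      (𝓝 (inner ℝ (gradient P.f z) (w - z) + M / 2 * ‖w - z‖ ^ 2)) :=
    (hg.inner (tendsto_const_nhds.sub hx)).add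
      (((tendsto_const_nhds.sub hx).norm.pow 2).const_mul _)
  have := le_of_tendsto_of_tendsto (hL.add_const (P.pen z)) (hR.add_const (P.pen w)) ?_
  · simpa using this
  filter_upwards [P.eventually_supp_pgPoints_eq hx hxbar hz hμ hμM hpg] with k hk
  have h1 := ((P.mem_pgPoints_iff (hμ k)).1 (hpg k)).2 w hw
  rw [P.pen_congr hk.1 hk.2] at h1
  have h2 : 0 ≤ μ k / 2 * ‖xbar k - x k‖ ^ 2 := by have := (hμ k).le; positivity
  have h3 : μ k / 2 * ‖w - x k‖ ^ 2 ≤ M / 2 * ‖w - x k‖ ^ 2 := by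
    have := hμM k
    gcongr
  linarith

end Limits

/-! ### The quadratic model -/

theorem hasGradientAt_model {G : Matrix (Fin n) (Fin n) ℝ} (hG : G.IsHermitian) (c : ℝ)
    (g x y : E n) :
    HasGradientAt (fun w : E n => c + inner ℝ g (w - x)
      + 1 / 2 * inner ℝ (w - x) (Matrix.toEuclideanLin G (w - x)))
      (g + Matrix.toEuclideanLin G (y - x)) y := by
  let T : E n →L[ℝ] E n := LinearMap.toContinuousLinearMap (Matrix.toEuclideanLin G)
  have hid : HasFDerivAt (fun w : E n => w - x) (ContinuousLinearMap.id ℝ (E n)) y :=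
    (hasFDerivAt_id y).sub_const x
  have hT : HasFDerivAt (fun w : E n => T (w - x)) (T.comp (ContinuousLinearMap.id ℝ (E n))) y :=
    T.hasFDerivAt.comp y hid
  have h1 := (((hasFDerivAt_const g y).inner ℝ hid).const_add c).add
    ((hid.inner ℝ hT).const_mul (1 / 2))
  rw [hasGradientAt_iff_hasFDerivAt]
  refine h1.congr_fderiv ?_
  ext v
  have hc := inner_toEuclideanLin_comm hG (y - x) v
  simp [T, hc, inner_sub_right, real_inner_comm v]
  ring

theorem Theta_self {G : Matrix (Fin n) (Fin n) ℝ} {x : E n} (hx : x ∈ P.Ω) :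
    P.Theta G x x = P.f x := by
  rw [Theta, coe_add_indicatorFun_of_mem _ (P.mem_Pi_self hx)]
  simp

theorem mem_Pi_and_model_le {G : Matrix (Fin n) (Fin n) ℝ} {x y : E n} (hx : x ∈ P.Ω)
    (h : P.Theta G x y ≤ P.Theta G x x) :
    y ∈ P.Pi x ∧ inner ℝ (gradient P.f x) (y - x)
      + 1 / 2 * inner ℝ (y - x) (Matrix.toEuclideanLin G (y - x)) ≤ 0 := by
  rw [P.Theta_self hx] at h
  have hy : y ∈ P.Pi x :=
    mem_of_coe_add_indicatorFun_ne_top (ne_top_of_le_ne_top (EReal.coe_ne_top _) h)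
  rw [Theta, coe_add_indicatorFun_of_mem _ hy, EReal.coe_le_coe_iff] at h
  exact ⟨hy, by linarith⟩

theorem exists_residual {G : Matrix (Fin n) (Fin n) ℝ} (hG : G.IsHermitian) {x y : E n} {c c' : ℝ}
    (hc : c < c') (h0 : 0 < c')
    (h : Metric.infEDist 0 (limitingSubdiff (P.Theta G x) y) ≤ ENNReal.ofReal c) :
    ∃ w : E n, ‖w‖ ≤ c' ∧
      w - (gradient P.f x + Matrix.toEuclideanLin G (y - x)) ∈ normalCone (P.Pi x) y := by
  -- The slack between `c` and `c'` avoids having to attain the distance.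
  obtain ⟨w, hw, hwc⟩ := Metric.infEDist_lt_iff.1
    (h.trans_lt ((ENNReal.ofReal_lt_ofReal_iff h0).2 hc))
  refine ⟨w, ?_, sub_gradient_mem_normalCone_of_mem_limitingSubdiff
    (g := fun y => gradient P.f x + Matrix.toEuclideanLin G (y - x)) (P.convex_Pi x)
    (fun y => hasGradientAt_model hG (P.f x) _ x y) ?_ hw⟩
  · rw [edist_comm, edist_zero_right, ← ofReal_norm,
      ENNReal.ofReal_lt_ofReal_iff h0] at hwc
    exact hwc.le
  · exact continuous_const.add
      ((Matrix.toEuclideanLin G).continuous_of_finiteDimensional.comp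
        (continuous_id.sub continuous_const))

end Problem

namespace Run

variable {n p : ℕ} {P : Problem n p} {θ : Params} (R : Run P θ)

/-! ### Feasibility and bounds along a run -/

/-- The accepted proximal parameter. -/
def mubar (k : ℕ) : ℝ := R.μ k * θ.τ ^ R.m k

/-- The residual `‖μ̄ₖ (xᵏ - x̄ᵏ)‖`. -/
def rho (k : ℕ) : ℝ := ‖R.mubar k • (R.x k - R.xbar k)‖

theorem mu_pos (k : ℕ) : 0 < R.μ k := θ.μmin_pos.trans_le (R.μ_mem k).1

theorem mu_mul_tau_pow_pos (k j : ℕ) : 0 < R.μ k * θ.τ ^ j :=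
  mul_pos (R.mu_pos k) (pow_pos (zero_lt_one.trans θ.one_lt_τ) _)

theorem mubar_pos (k : ℕ) : 0 < R.mubar k := R.mu_mul_tau_pow_pos k _

theorem muMin_le_mubar (k : ℕ) : θ.μmin ≤ R.mubar k :=
  (R.μ_mem k).1.trans (le_mul_of_one_le_right (R.mu_pos k).le (one_le_pow₀ θ.one_lt_τ.le))

theorem rho_eq (k : ℕ) : R.rho k = R.mubar k * ‖R.x k - R.xbar k‖ := by
  rw [rho, norm_smul, Real.norm_eq_abs, abs_of_pos (R.mubar_pos k)]

theorem rho_pos (k : ℕ) : 0 < R.rho k := by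
  rw [rho_eq]
  exact not_stop R k

theorem xbar_mem_pgPoints (k : ℕ) : R.xbar k ∈ P.pgPoints (R.mubar k) (R.x k) := R.xbar_mem k

theorem xbar_mem_Ω (k : ℕ) : R.xbar k ∈ P.Ω :=
  ((P.mem_pgPoints_iff (R.mubar_pos k)).1 (R.xbar_mem_pgPoints k)).1

theorem beta_pow_mem (j : ℕ) : θ.β ^ j ∈ Ioc (0 : ℝ) 1 :=
  ⟨pow_pos θ.β_mem.1 _, pow_le_one₀ θ.β_mem.1.le θ.β_mem.2.le⟩

theorem y_mem_and_model_le {k : ℕ} (hx : R.x k ∈ P.Ω) (hs : P.Switch (R.x k) (R.xbar k)) :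
    R.y k ∈ P.Pi (R.x k) ∧ inner ℝ (gradient P.f (R.x k)) (R.d k)
      + 1 / 2 * inner ℝ (R.d k) (Matrix.toEuclideanLin (R.G k) (R.d k)) ≤ 0 :=
  P.mem_Pi_and_model_le hx (R.inexact_value k hs)

theorem segment_mem_Pi {k : ℕ} (hx : R.x k ∈ P.Ω) (hs : P.Switch (R.x k) (R.xbar k)) {s : ℝ}
    (h : s ∈ Icc (0 : ℝ) 1) : R.x k + s • R.d k ∈ P.Pi (R.x k) :=
  (P.convex_Pi _).add_smul_sub_mem (P.mem_Pi_self hx) (R.y_mem_and_model_le hx hs).1 h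

theorem x_mem_Ω (k : ℕ) : R.x k ∈ P.Ω := by
  induction k with
  | zero => exact R.x_zero_mem
  | succ k ih =>
    by_cases hs : P.Switch (R.x k) (R.xbar k)
    · rw [R.newton_step k hs]
      exact (R.segment_mem_Pi ih hs (Ioc_subset_Icc_self (beta_pow_mem (R.t k)))).1
    · rw [R.pg_step k hs]
      exact R.xbar_mem_Ω k

theorem y_mem_Pi {k : ℕ} (hs : P.Switch (R.x k) (R.xbar k)) : R.y k ∈ P.Pi (R.x k) :=
  (R.y_mem_and_model_le (R.x_mem_Ω k) hs).1

theorem x_succ_mem_Pi {k : ℕ} (hs : P.Switch (R.x k) (R.xbar k)) :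
    R.x (k + 1) ∈ P.Pi (R.x k) := by
  rw [R.newton_step k hs]
  exact R.segment_mem_Pi (R.x_mem_Ω k) hs (Ioc_subset_Icc_self (beta_pow_mem (R.t k)))

/-- The last rejected parameter, smaller by the factor τ, must lie below L + α. -/
theorem exists_mubar_le : ∃ M, ∀ k, R.mubar k ≤ M := by
  obtain ⟨L, -, hL⟩ := exists_hess_norm_le P.contDiff_f P.isCompact_Ω
  refine ⟨max θ.μmax (θ.τ * (L + θ.α)), fun k => ?_⟩
  rcases Nat.eq_zero_or_pos (R.m k) with h0 | hpos
  · rw [mubar, h0, pow_zero, mul_one]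
    exact (R.μ_mem k).2.trans (le_max_left _ _)
  · obtain ⟨j, hj⟩ := Nat.exists_eq_succ_of_ne_zero hpos.ne'
    obtain ⟨z, hz, hlt⟩ := R.xbar_first k j (hj ▸ Nat.lt_succ_self j)
    have hlt' : R.μ k * θ.τ ^ j < L + θ.α := by
      by_contra! hcon
      exact absurd (P.F_le_of_mem_pgPoints hL (R.mu_mul_tau_pow_pos k j) hcon (R.x_mem_Ω k) hz)
        (not_le.2 hlt)
    refine le_max_of_le_right ?_
    rw [mubar, hj, pow_succ]
    nlinarith [θ.one_lt_τ]

theorem exists_rho_le : ∃ r, ∀ k, R.rho k ≤ r := by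
  obtain ⟨M, hM⟩ := R.exists_mubar_le
  obtain ⟨D, hD⟩ := P.isCompact_Ω.isBounded.exists_norm_le
  refine ⟨M * (D + D), fun k => ?_⟩
  rw [R.rho_eq]
  have h1 : ‖R.x k - R.xbar k‖ ≤ D + D :=
    (norm_sub_le _ _).trans (add_le_add (hD _ (R.x_mem_Ω k)) (hD _ (R.xbar_mem_Ω k)))
  exact mul_le_mul (hM k) h1 (norm_nonneg _) ((R.mubar_pos k).le.trans (hM k))

theorem exists_isModelMatrix : ∃ M, 0 < M ∧ ∀ k, P.Switch (R.x k) (R.xbar k) →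
    IsModelMatrix P.f (R.x k) (θ.b₁ * R.rho k ^ θ.σ) M (R.G k) := by
  obtain ⟨r, hr⟩ := R.exists_rho_le
  obtain ⟨M, hM⟩ := exists_isModelMatrix_G₃ P.contDiff_f θ P.isCompact_Ω r
  rcases R.G_choice with h | ⟨S, h⟩
  · refine ⟨max M 1, by positivity, fun k hk => ?_⟩
    rw [h k hk]
    exact (hM _ (R.x_mem_Ω k) _ (R.rho_pos k).le (hr k)).mono (le_max_left _ _)
  · obtain ⟨M', hM'⟩ := exists_isModelMatrix_sepRepr P.contDiff_f θ S P.isCompact_Ω r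
    refine ⟨max (max M M') 1, by positivity, fun k hk => ?_⟩
    have h1 := hM' _ (R.x_mem_Ω k) _ (R.rho_pos k).le (hr k)
    have hle : M' ≤ max (max M M') 1 := (le_max_right _ _).trans (le_max_left _ _)
    rcases h k hk with h | h | h
    · rw [h]
      exact h1.1.mono hle
    · rw [h]
      exact h1.2.mono hle
    · rw [h]
      exact (hM _ (R.x_mem_Ω k) _ (R.rho_pos k).le (hr k)).mono
        ((le_max_left _ _).trans (le_max_left _ _))

/-! ### Estimates for the Newton direction -/

theorem exists_residual {k : ℕ} (hs : P.Switch (R.x k) (R.xbar k)) {κ M : ℝ}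
    (hG : IsModelMatrix P.f (R.x k) κ M (R.G k)) :
    ∃ w : E n, ‖w‖ ≤ 3 / 4 * R.rho k ∧ ‖w‖ ≤ R.rho k ^ (1 + θ.ς) ∧
      w - (gradient P.f (R.x k) + Matrix.toEuclideanLin (R.G k) (R.d k)) ∈
        normalCone (P.Pi (R.x k)) (R.y k) := by
  have hρ := R.rho_pos k
  have hρς : 0 < R.rho k ^ (1 + θ.ς) := Real.rpow_pos_of_pos hρ _
  set a := min (R.mubar k)⁻¹ 1 with ha
  set b := min (R.rho k) (R.rho k ^ (1 + θ.ς)) with hb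
  have ha0 : 0 < a := lt_min (inv_pos.2 (R.mubar_pos k)) one_pos
  have ha1 : a ≤ 1 := min_le_right _ _
  have hb0 : 0 < b := lt_min hρ hρς
  have hab : 0 < a * b := mul_pos ha0 hb0
  have hab' : a * b ≤ b := mul_le_of_le_one_left hb0.le ha1
  -- The factor 1/2 of the inexactness test is relaxed to 3/4; being below 1, it still lets ‖w‖ be
  -- absorbed into ρ.
  obtain ⟨w, hw, hmem⟩ := P.exists_residual hG.isHermitian (c := a / 2 * b) (c' := 3 / 4 * (a * b))
    (by linarith) (by linarith) (R.inexact_dist k hs)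
  refine ⟨w, ?_, ?_, hmem⟩
  · linarith [min_le_left (R.rho k) (R.rho k ^ (1 + θ.ς))]
  · linarith [min_le_right (R.rho k) (R.rho k ^ (1 + θ.ς))]

/-- The Newton direction `d` and the proximal residual `ρ` satisfy `ρ ≤ c₁ ‖d‖` and
`ρ^σ ‖d‖ ≤ c₂ ρ`. -/
theorem exists_rho_le_norm_d : ∃ c₁ c₂ : ℝ, 0 < c₁ ∧ 0 < c₂ ∧
    ∀ k, P.Switch (R.x k) (R.xbar k) →
      R.rho k ≤ c₁ * ‖R.d k‖ ∧ R.rho k ^ θ.σ * ‖R.d k‖ ≤ c₂ * R.rho k := by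
  obtain ⟨Mμ, hMμ⟩ := R.exists_mubar_le
  obtain ⟨M, hM0, hM⟩ := R.exists_isModelMatrix
  have hMμ0 : 0 < Mμ := (R.mubar_pos 0).trans_le (hMμ 0)
  have hμmin := θ.μmin_pos
  have hb₁ := θ.b₁_pos
  -- The bound derived below is ρ ≤ (2μ + M)‖d‖ + (3/4)ρ; absorbing the last term produces the
  -- factor 4.
  set c₁ := 4 * (2 * Mμ + M) with hc₁
  have hc₁0 : 0 < c₁ := by positivity
  refine ⟨c₁, (M / θ.μmin + 2 + c₁ / θ.μmin) / θ.b₁, hc₁0, by positivity, fun k hs => ?_⟩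
  have hGk := hM k hs
  obtain ⟨w, hw, -, hwN⟩ := R.exists_residual hs hGk
  have hμ := R.mubar_pos k
  set μ := R.mubar k with hμdef
  set d := R.d k with hd
  set e := R.xbar k - R.x k with he
  set Gd := Matrix.toEuclideanLin (R.G k) d with hGd
  have hρe : R.rho k = μ * ‖e‖ := by rw [R.rho_eq, norm_sub_rev]
  have hρ := R.rho_pos k
  have h1 := (P.neg_gradient_sub_mem_normalCone hμ (R.xbar_mem_pgPoints k) hs).2 _ (R.y_mem_Pi hs)
  have h2 := hwN.2 _ (P.mem_Pi_of_switch (R.xbar_mem_Ω k) hs)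
  have e1 : R.y k - R.xbar k = d - e := by rw [hd, he, Run.d]; abel
  have e2 : R.xbar k - R.y k = -(d - e) := by rw [← e1]; abel
  rw [e1, ← he] at h1
  rw [e2, inner_neg_right] at h2
  clear_value e
  -- Monotonicity: the optimality conditions at x̄ᵏ and yᵏ, each tested at the other point, are
  -- added, and ∇f(xᵏ) cancels.
  have hsum : inner ℝ (Gd - w - μ • e) (d - e) ≤ 0 := by
    have : Gd - w - μ • e = (-gradient P.f (R.x k) - μ • e)
        - (w - (gradient P.f (R.x k) + Gd)) := by abel
    rw [this, inner_sub_left]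
    linarith
  have hGnorm : ‖Gd‖ ≤ M * ‖d‖ := hGk.norm_le d
  have hμMμ : μ ≤ Mμ := hMμ k
  have hd0 := norm_nonneg d
  have he0 := norm_nonneg e
  have hρd : R.rho k ≤ c₁ * ‖d‖ := by
    set u := d - e with hu
    have h3 : μ * ‖u‖ ^ 2 ≤ inner ℝ (μ • d + w - Gd) u := by
      have : Gd - w - μ • e = μ • u - (μ • d + w - Gd) := by rw [hu, smul_sub]; abel
      rw [this, inner_sub_left, inner_smul_left, real_inner_self_eq_norm_sq] at hsum
      simpa using hsum
    have h4 : ‖μ • d + w - Gd‖ ≤ μ * ‖d‖ + ‖w‖ + M * ‖d‖ := by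
      refine (norm_sub_le _ _).trans (add_le_add ((norm_add_le _ _).trans ?_) hGnorm)
      rw [norm_smul, Real.norm_eq_abs, abs_of_pos hμ]
    have h5 := h3.trans ((real_inner_le_norm _ _).trans
      (mul_le_mul_of_nonneg_right h4 (norm_nonneg u)))
    have h6 : μ * ‖u‖ ≤ μ * ‖d‖ + ‖w‖ + M * ‖d‖ := by
      rcases (norm_nonneg u).eq_or_lt with h0 | h0
      · rw [← h0, mul_zero]
        positivity
      · refine le_of_mul_le_mul_right ?_ h0
        linarith [h5]
    have h7 : ‖e‖ ≤ ‖d‖ + ‖u‖ := by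
      have : e = d - u := by rw [hu]; abel
      rw [this]
      exact norm_sub_le _ _
    have h8 : μ * ‖e‖ ≤ μ * ‖d‖ + μ * ‖u‖ := by
      rw [← mul_add]
      gcongr
    have h9 : μ * ‖d‖ ≤ Mμ * ‖d‖ := by gcongr
    rw [hc₁]
    linarith
  refine ⟨hρd, ?_⟩
  have hd1 : 0 < ‖d‖ := pos_of_mul_pos_right (hρ.trans_le hρd) hc₁0.le
  -- For the second bound, the same inequality is expanded and ⟨d, Gd⟩ is kept on the left, where it
  -- dominates b₁ρ^σ‖d‖².
  have h3 := hGk.le_inner d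
  rw [inner_sub_left, inner_sub_left, inner_sub_right, inner_sub_right, inner_sub_right,
    inner_smul_left, inner_smul_left, real_inner_self_eq_norm_sq, conj_trivial,
    real_inner_comm d Gd] at hsum
  have h4 : inner ℝ Gd e ≤ M * ‖d‖ * ‖e‖ :=
    (real_inner_le_norm _ _).trans (mul_le_mul_of_nonneg_right hGnorm he0)
  have h5 : μ * inner ℝ e d ≤ R.rho k * ‖d‖ := by
    rw [hρe, mul_assoc]
    exact mul_le_mul_of_nonneg_left (real_inner_le_norm _ _) hμ.le
  have h6 : inner ℝ w d ≤ R.rho k * ‖d‖ :=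
    (real_inner_le_norm _ _).trans (mul_le_mul_of_nonneg_right (by linarith) hd0)
  have h7 : -inner ℝ w e ≤ R.rho k * ‖e‖ := by
    have := (abs_le.1 (abs_real_inner_le_norm w e)).1
    have := mul_le_mul_of_nonneg_right (show ‖w‖ ≤ R.rho k by linarith) he0
    linarith
  have h8 : ‖e‖ ≤ R.rho k / θ.μmin := by
    rw [le_div_iff₀ hμmin, hρe, mul_comm]
    exact mul_le_mul_of_nonneg_right (R.muMin_le_mubar k) he0
  have h9 : M * ‖d‖ * ‖e‖ ≤ M * ‖d‖ * (R.rho k / θ.μmin) := by gcongr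
  have h10 : R.rho k * ‖e‖ ≤ c₁ * ‖d‖ * (R.rho k / θ.μmin) := by gcongr
  have h11 : 0 ≤ μ * ‖e‖ ^ 2 := by positivity
  have h12 : θ.b₁ * R.rho k ^ θ.σ * ‖d‖ ^ 2 ≤
      (M / θ.μmin + 2 + c₁ / θ.μmin) * R.rho k * ‖d‖ := by
    have e3 : (M / θ.μmin + 2 + c₁ / θ.μmin) * R.rho k * ‖d‖ = M * ‖d‖ * (R.rho k / θ.μmin)
      + R.rho k * ‖d‖ + R.rho k * ‖d‖ + c₁ * ‖d‖ * (R.rho k / θ.μmin) := by ring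
    linarith
  have h13 : θ.b₁ * (R.rho k ^ θ.σ * ‖d‖) ≤ (M / θ.μmin + 2 + c₁ / θ.μmin) * R.rho k := by
    refine le_of_mul_le_mul_right ?_ hd1
    linarith
  rw [div_mul_eq_mul_div, le_div_iff₀ hb₁]
  linarith

theorem inner_gradient_d_le {k : ℕ} (hs : P.Switch (R.x k) (R.xbar k)) :
    inner ℝ (gradient P.f (R.x k)) (R.d k) ≤ -(θ.b₁ / 2 * R.rho k ^ θ.σ * ‖R.d k‖ ^ 2) := by
  obtain ⟨M, -, hM⟩ := R.exists_isModelMatrix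
  have h1 := (R.y_mem_and_model_le (R.x_mem_Ω k) hs).2
  have h2 := (hM k hs).le_inner (R.d k)
  linarith

theorem f_succ_le {k : ℕ} (hs : P.Switch (R.x k) (R.xbar k)) :
    P.f (R.x (k + 1)) ≤
      P.f (R.x k) + θ.ϱ * θ.β ^ R.t k * inner ℝ (gradient P.f (R.x k)) (R.d k) := by
  rw [R.newton_step k hs]
  exact (R.newton_search k hs).1

/-- The step size of the line search is at least of the order `ρ^σ`. -/
theorem exists_le_step : ∃ c : ℝ, 0 < c ∧ ∀ k, P.Switch (R.x k) (R.xbar k) →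
    min 1 (c * R.rho k ^ θ.σ) ≤ θ.β ^ R.t k := by
  obtain ⟨L, hL0, hL⟩ := exists_hess_norm_le P.contDiff_f P.isCompact_Ω
  obtain ⟨c₁, c₂, hc₁, -, hc⟩ := R.exists_rho_le_norm_d
  have hβ := θ.β_mem.1
  have hb₁ := θ.b₁_pos
  have hϱ := θ.ϱ_mem
  have hϱ1 : 0 < 1 - θ.ϱ := by linarith [hϱ.2]
  refine ⟨θ.β * ((1 - θ.ϱ) * θ.b₁ / L), by positivity, fun k hs => ?_⟩
  rcases Nat.eq_zero_or_pos (R.t k) with h0 | hpos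
  · rw [h0, pow_zero]
    exact min_le_left _ _
  obtain ⟨j, hj⟩ := Nat.exists_eq_succ_of_ne_zero hpos.ne'
  refine min_le_of_right_le ?_
  -- The preceding trial step β^(t-1) was rejected; comparison with the Taylor bound shows that it
  -- was not small, and one factor β is lost.
  have hnot : ¬ P.f (R.x k + θ.β ^ j • R.d k) ≤
      P.f (R.x k) + θ.ϱ * θ.β ^ j * inner ℝ (gradient P.f (R.x k)) (R.d k) := fun hcon => by
    have := (R.newton_search k hs).2 hcon
    omega
  push Not at hnot
  set s := θ.β ^ j with hsdef
  have hs1 : s ∈ Ioc (0 : ℝ) 1 := beta_pow_mem j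
  have hTaylor := le_of_hess_norm_le P.contDiff_f P.convex_Ω hL (d := s • R.d k) (R.x_mem_Ω k)
    (R.segment_mem_Pi (R.x_mem_Ω k) hs (Ioc_subset_Icc_self hs1)).1
  rw [inner_smul_right, norm_smul, Real.norm_eq_abs, abs_of_pos hs1.1] at hTaylor
  have hdec := R.inner_gradient_d_le hs
  have hd : 0 < ‖R.d k‖ := pos_of_mul_pos_right ((R.rho_pos k).trans_le (hc k hs).1) hc₁.le
  set q := inner ℝ (gradient P.f (R.x k)) (R.d k) with hq
  have h1 : 0 < s * ((1 - θ.ϱ) * q + L / 2 * s * ‖R.d k‖ ^ 2) := by nlinarith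
  have h2 : 0 < (1 - θ.ϱ) * q + L / 2 * s * ‖R.d k‖ ^ 2 := pos_of_mul_pos_right h1 hs1.1.le
  have h3 : (1 - θ.ϱ) * q ≤ (1 - θ.ϱ) * -(θ.b₁ / 2 * R.rho k ^ θ.σ * ‖R.d k‖ ^ 2) := by gcongr
  have h4 : ((1 - θ.ϱ) * θ.b₁ * R.rho k ^ θ.σ) * ‖R.d k‖ ^ 2 ≤ (L * s) * ‖R.d k‖ ^ 2 := by
    linarith
  have h5 : (1 - θ.ϱ) * θ.b₁ * R.rho k ^ θ.σ ≤ L * s := le_of_mul_le_mul_right h4 (by positivity)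
  rw [hj, Nat.succ_eq_add_one, pow_succ, ← hsdef, mul_comm s, mul_assoc]
  gcongr
  rw [div_mul_eq_mul_div, div_le_iff₀ hL0]
  linarith

/-! ### Sufficient decrease and vanishing residual -/

/-- A modulus of decrease of the objective in terms of `‖x - x̄‖`. -/
theorem exists_decrease {ε : ℝ} (hε : 0 < ε) : ∃ δ, 0 < δ ∧
    ∀ k, ε ≤ ‖R.x k - R.xbar k‖ → P.F (R.x (k + 1)) ≤ P.F (R.x k) - δ := by
  obtain ⟨c₁, c₂, hc₁, -, hc⟩ := R.exists_rho_le_norm_d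
  obtain ⟨c, hc0, hstep⟩ := R.exists_le_step
  have hα := θ.α_pos
  have hb₁ := θ.b₁_pos
  have hϱ := θ.ϱ_mem.1
  have hμ := θ.μmin_pos
  have hσ := θ.σ_mem.1
  set r := θ.μmin * ε with hr
  have hr0 : 0 < r := by positivity
  have hrσ : 0 < r ^ θ.σ := Real.rpow_pos_of_pos hr0 _
  -- The Newton decrease ϱβᵗ(b₁/2)ρ^σ‖d‖² evaluated at its worst case ρ = r, ‖d‖ = r/c₁.
  set δ₂ := θ.ϱ * min 1 (c * r ^ θ.σ) * (θ.b₁ / 2 * r ^ θ.σ * (r / c₁) ^ 2) with hδ₂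
  have hmin : 0 < min 1 (c * r ^ θ.σ) := lt_min one_pos (by positivity)
  have hδ₂0 : 0 < δ₂ := by positivity
  refine ⟨min (θ.α / 2 * ε ^ 2) δ₂, by positivity, fun k hk => ?_⟩
  by_cases hs : P.Switch (R.x k) (R.xbar k)
  · have hpen := P.pen_mono (R.x_succ_mem_Pi hs).2.1 (R.x_succ_mem_Pi hs).2.2
    have h1 := R.f_succ_le hs
    have h2 := R.inner_gradient_d_le hs
    have hρ : r ≤ R.rho k := by
      rw [R.rho_eq]
      exact mul_le_mul (R.muMin_le_mubar k) hk hε.le (R.mubar_pos k).le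
    have hρσ : r ^ θ.σ ≤ R.rho k ^ θ.σ := Real.rpow_le_rpow hr0.le hρ hσ.le
    have hd : r / c₁ ≤ ‖R.d k‖ := by
      rw [div_le_iff₀ hc₁, mul_comm]
      exact hρ.trans (hc k hs).1
    have hst : min 1 (c * r ^ θ.σ) ≤ θ.β ^ R.t k :=
      (min_le_min_left 1 (by gcongr)).trans (hstep k hs)
    have h3 : δ₂ ≤ θ.ϱ * θ.β ^ R.t k * (θ.b₁ / 2 * R.rho k ^ θ.σ * ‖R.d k‖ ^ 2) := by
      have hβ := θ.β_mem.1
      have hρ0 := R.rho_pos k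
      rw [hδ₂]
      gcongr
    have h4 : θ.ϱ * θ.β ^ R.t k * inner ℝ (gradient P.f (R.x k)) (R.d k) ≤
        θ.ϱ * θ.β ^ R.t k * -(θ.b₁ / 2 * R.rho k ^ θ.σ * ‖R.d k‖ ^ 2) :=
      mul_le_mul_of_nonneg_left h2 (mul_nonneg hϱ.le (beta_pow_mem _).1.le)
    have := min_le_right (θ.α / 2 * ε ^ 2) δ₂
    unfold Problem.F
    linarith
  · rw [R.pg_step k hs]
    have h1 := R.xbar_descent k
    have h2 : θ.α / 2 * ε ^ 2 ≤ θ.α / 2 * ‖R.x k - R.xbar k‖ ^ 2 := by gcongr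
    have := min_le_left (θ.α / 2 * ε ^ 2) δ₂
    linarith

theorem strictAnti_F : StrictAnti fun k => P.F (R.x k) := by
  refine strictAnti_nat_of_succ_lt fun k => ?_
  have hpos : 0 < ‖R.x k - R.xbar k‖ :=
    pos_of_mul_pos_right (not_stop R k) (R.mubar_pos k).le
  obtain ⟨δ, hδ, h⟩ := R.exists_decrease hpos
  linarith [h k le_rfl]

theorem exists_tendsto_F : ∃ c, Tendsto (fun k => P.F (R.x k)) atTop (𝓝 c) := by
  refine ⟨_, tendsto_atTop_ciInf R.strictAnti_F.antitone ?_⟩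
  obtain ⟨D, hD⟩ := P.isCompact_Ω.exists_bound_of_continuousOn (f := P.f)
    P.contDiff_f.continuous.continuousOn
  refine ⟨-D, ?_⟩
  rintro _ ⟨k, rfl⟩
  have h1 := hD _ (R.x_mem_Ω k)
  rw [Real.norm_eq_abs] at h1
  have h2 := (abs_le.1 h1).1
  have h3 : 0 ≤ P.pen (R.x k) := by
    have := P.lam₁_pos
    have := P.lam₂_pos
    unfold Problem.pen
    positivity
  simp only [Problem.F]
  linarith

theorem tendsto_x_sub_xbar : Tendsto (fun k => R.x k - R.xbar k) atTop (𝓝 0) := by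
  rw [tendsto_zero_iff_norm_tendsto_zero]
  obtain ⟨c, hc⟩ := R.exists_tendsto_F
  have hdiff : Tendsto (fun k => P.F (R.x k) - P.F (R.x (k + 1))) atTop (𝓝 0) := by
    simpa using hc.sub (hc.comp (tendsto_add_atTop_nat 1))
  refine Metric.tendsto_nhds.2 fun ε hε => ?_
  obtain ⟨δ, hδ, h⟩ := R.exists_decrease hε
  filter_upwards [hdiff.eventually_lt_const hδ] with k hk
  rw [dist_zero_right, norm_norm]
  by_contra! hcon
  linarith [h k hcon]

theorem tendsto_rho : Tendsto R.rho atTop (𝓝 0) := by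
  obtain ⟨M, hM⟩ := R.exists_mubar_le
  have h := (tendsto_zero_iff_norm_tendsto_zero.1 R.tendsto_x_sub_xbar).const_mul M
  rw [mul_zero] at h
  refine squeeze_zero (fun k => (R.rho_pos k).le) (fun k => ?_) h
  rw [R.rho_eq]
  exact mul_le_mul_of_nonneg_right (hM k) (norm_nonneg _)

/-! ### Identification of the supports -/

theorem mem_Ω_of_mapClusterPt {z : E n} (hz : MapClusterPt z atTop R.x) : z ∈ P.Ω :=
  P.isCompact_Ω.isClosed.mem_of_mapClusterPt hz (Eventually.of_forall R.x_mem_Ω)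

theorem tendsto_xbar_comap (z : E n) : Tendsto R.xbar (atTop ⊓ comap R.x (𝓝 z)) (𝓝 z) := by
  have h := (tendsto_comap_nhds R.x z).sub (R.tendsto_x_sub_xbar.mono_left inf_le_left)
  simpa using h

theorem eventually_supp_xbar_subset :
    ∀ᶠ k in atTop, P.supp (R.xbar k) ⊆ P.supp (R.x k) ∧ P.suppB (R.xbar k) ⊆ P.suppB (R.x k) := by
  obtain ⟨M, hM⟩ := R.exists_mubar_le
  refine eventually_of_forall_comap_nhds P.isCompact_Ω (Eventually.of_forall R.x_mem_Ω)
    fun z hz => ?_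
  have hx := tendsto_comap_nhds R.x z
  filter_upwards [P.eventually_supp_pgPoints_eq hx (R.tendsto_xbar_comap z)
    (R.mem_Ω_of_mapClusterPt hz) R.mubar_pos hM R.xbar_mem_pgPoints,
    hx.eventually (P.eventually_supp_subset z)] with k hk1 hk2
  exact ⟨hk1.1.subset.trans hk2.1, hk1.2.subset.trans hk2.2⟩

/-- The supports eventually decrease: a Newton step stays in Π(xᵏ), and a proximal step moves to
x̄ᵏ, whose supports are contained in those of xᵏ. A decreasing sequence of finite sets is eventually
constant. -/
theorem exists_forall_switch : ∃ K, ∀ k ≥ K, P.Switch (R.x k) (R.xbar k) ∧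
    P.supp (R.x k) = P.supp (R.x K) ∧ P.suppB (R.x k) = P.suppB (R.x K) := by
  obtain ⟨K₀, hK₀⟩ := eventually_atTop.1 R.eventually_supp_xbar_subset
  let S : ℕ → Set (Fin n) × Set (Fin p) := fun j => (P.supp (R.x (K₀ + j)), P.suppB (R.x (K₀ + j)))
  have hS : Antitone S := by
    refine antitone_nat_of_succ_le fun j => ?_
    by_cases hs : P.Switch (R.x (K₀ + j)) (R.xbar (K₀ + j))
    · exact (R.x_succ_mem_Pi hs).2
    · have := hK₀ (K₀ + j) (by omega)
      rw [← R.pg_step _ hs] at this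
      exact this
  obtain ⟨N, hN⟩ := WellFoundedGT.monotone_chain_condition
    (⟨fun j => OrderDual.toDual (S j), fun i j h => hS h⟩ : ℕ →o (Set (Fin n) × Set (Fin p))ᵒᵈ)
  have hN' : ∀ j ≥ N, S N = S j := fun j hj => hN j hj
  have hconst : ∀ k ≥ K₀ + N, P.supp (R.x k) = P.supp (R.x (K₀ + N)) ∧
      P.suppB (R.x k) = P.suppB (R.x (K₀ + N)) := by
    intro k hk
    have h1 := hN' (k - K₀) (by omega)
    rw [Prod.ext_iff] at h1
    simp only [S, show K₀ + (k - K₀) = k by omega] at h1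
    exact ⟨h1.1.symm, h1.2.symm⟩
  refine ⟨K₀ + N, fun k hk => ⟨?_, hconst k hk⟩⟩
  -- A failed switch would make xᵏ⁺¹ = x̄ᵏ, whose supports differ from those of xᵏ, although they no
  -- longer change.
  by_contra hs
  have h1 := hconst k hk
  have h2 := hconst (k + 1) (by omega)
  rw [R.pg_step k hs] at h2
  exact hs ⟨h1.1.trans h2.1.symm, h1.2.trans h2.2.symm⟩

end Run

theorem neBot_inf_comap_of_mapClusterPt {α : Type*} [TopologicalSpace α] {x : ℕ → α} {z : α}
    (h : MapClusterPt z atTop x) : NeBot (atTop ⊓ comap x (𝓝 z)) := by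
  rw [neBot_inf_comap_iff_map, inf_comm]
  exact h

namespace Run

variable {n p : ℕ} {P : Problem n p} {θ : Params} (R : Run P θ)

/-! ### The final phase: Newton steps on a fixed polytope -/

theorem eventually_switch : ∀ᶠ k in atTop, P.Switch (R.x k) (R.xbar k) := by
  obtain ⟨K, hK⟩ := R.exists_forall_switch
  filter_upwards [eventually_ge_atTop K] with k hk using (hK k hk).1

theorem exists_PiStar_eq : ∃ a, R.PiStar = P.Pi a ∧
    ∀ᶠ k in atTop, P.Pi (R.x k) = R.PiStar ∧ P.pen (R.x k) = P.pen a := by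
  obtain ⟨K, hK⟩ := R.exists_forall_switch
  have h : ∀ᶠ k in atTop, P.Pi (R.x k) = P.Pi (R.x K) ∧ P.pen (R.x k) = P.pen (R.x K) := by
    filter_upwards [eventually_ge_atTop K] with k hk
    exact ⟨P.Pi_congr (hK k hk).2.1 (hK k hk).2.2, P.pen_congr (hK k hk).2.1 (hK k hk).2.2⟩
  have heq := R.PiStar_eq (h.mono fun _ h => h.1)
  exact ⟨R.x K, heq, by rwa [heq]⟩

theorem eventually_x_mem_PiStar : ∀ᶠ k in atTop, R.x k ∈ R.PiStar := by
  obtain ⟨a, -, h⟩ := R.exists_PiStar_eq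
  filter_upwards [h] with k hk
  rw [← hk.1]
  exact P.mem_Pi_self (R.x_mem_Ω k)

theorem mem_PiStar_of_mapClusterPt {z : E n} (hz : MapClusterPt z atTop R.x) : z ∈ R.PiStar := by
  obtain ⟨a, ha, -⟩ := R.exists_PiStar_eq
  have hclosed : IsClosed (P.Pi a) := by
    have : P.Pi a = P.Ω ∩ ({x | ∀ i, a i = 0 → x i = 0} ∩
        {x | ∀ j, P.B.mulVec a.ofLp j = 0 → P.B.mulVec x.ofLp j = 0}) := by
      ext x
      exact P.mem_Pi_iff
    rw [this]
    refine P.isCompact_Ω.isClosed.inter (IsClosed.inter ?_ ?_)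
    · simp only [ofPred_forall]
      exact isClosed_iInter fun i => isClosed_iInter fun _ =>
        isClosed_eq (Problem.continuous_coord i) continuous_const
    · simp only [ofPred_forall]
      exact isClosed_iInter fun j => isClosed_iInter fun _ =>
        isClosed_eq (P.continuous_mulVec_apply j) continuous_const
  rw [ha]
  exact hclosed.mem_of_mapClusterPt hz (ha ▸ R.eventually_x_mem_PiStar)

theorem eventually_normalCone_PiStar_subset {z : E n} (hz : MapClusterPt z atTop R.x) :
    ∀ᶠ y in 𝓝 z, normalCone R.PiStar y ⊆ normalCone R.PiStar z := by
  obtain ⟨a, ha, -⟩ := R.exists_PiStar_eq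
  have := R.mem_PiStar_of_mapClusterPt hz
  rw [ha] at this ⊢
  exact P.eventually_normalCone_subset this

theorem exists_norm_d_le : ∃ c : ℝ, 0 < c ∧ ∀ k, P.Switch (R.x k) (R.xbar k) →
    ‖R.d k‖ ≤ c * R.rho k ^ (1 - θ.σ) := by
  obtain ⟨_, c₂, _, hc₂, hc⟩ := R.exists_rho_le_norm_d
  refine ⟨c₂, hc₂, fun k hs => ?_⟩
  have hσ : 0 < R.rho k ^ θ.σ := Real.rpow_pos_of_pos (R.rho_pos k) _
  refine le_of_mul_le_mul_left ?_ hσ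
  have h := (hc k hs).2
  have e : R.rho k = R.rho k ^ θ.σ * R.rho k ^ (1 - θ.σ) := by
    rw [← Real.rpow_add (R.rho_pos k), add_sub_cancel, Real.rpow_one]
  nth_rewrite 2 [e] at h
  linarith

theorem tendsto_rho_rpow {s : ℝ} (hs : 0 < s) : Tendsto (fun k => R.rho k ^ s) atTop (𝓝 0) := by
  have := R.tendsto_rho.rpow_const (p := s) (Or.inr hs.le)
  rwa [Real.zero_rpow hs.ne'] at this

theorem tendsto_d : Tendsto R.d atTop (𝓝 0) := by
  obtain ⟨c, -, hc⟩ := R.exists_norm_d_le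
  have h := (R.tendsto_rho_rpow (s := 1 - θ.σ) (by linarith [θ.σ_mem.2])).const_mul c
  rw [mul_zero] at h
  exact squeeze_zero_norm' (R.eventually_switch.mono fun k hk => hc k hk) h

theorem tendsto_y_comap (z : E n) : Tendsto R.y (atTop ⊓ comap R.x (𝓝 z)) (𝓝 z) := by
  have h := (tendsto_comap_nhds R.x z).add (R.tendsto_d.mono_left inf_le_left)
  simpa [Run.d] using h

/-- The unit step passes the line search eventually. -/
theorem eventually_x_succ_eq_y (hLip : R.HessLocallyLipschitz) :
    ∀ᶠ k in atTop, R.x (k + 1) = R.y k := by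
  obtain ⟨O, hO, hsub, hOLip⟩ := hLip
  obtain ⟨M, -, hM⟩ := R.exists_isModelMatrix
  obtain ⟨c₁, _, hc₁, _, hc⟩ := R.exists_rho_le_norm_d
  obtain ⟨c₂, hc₂, hd⟩ := R.exists_norm_d_le
  have hσ := θ.σ_mem
  have hϱ := θ.ϱ_mem
  have hς := θ.ς_mem
  have hb₁ := θ.b₁_pos
  refine eventually_of_forall_comap_nhds P.isCompact_Ω (Eventually.of_forall R.x_mem_Ω)
    fun z hz => ?_
  obtain ⟨K, t, ht, hK⟩ := hOLip (hsub hz)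
  rw [hO.nhdsWithin_eq (hsub hz)] at ht
  obtain ⟨r, hr, hball⟩ := Metric.mem_nhds_iff.1 ht
  -- The residual term and the cubic Taylor term, relative to ρ^σ‖d‖²; the two exponents are
  -- positive since ς > σ and σ < 1/2.
  have hsmall : Tendsto (fun k => c₁ * R.rho k ^ (θ.ς - θ.σ)
      + K / 2 * c₂ * R.rho k ^ (1 - 2 * θ.σ)) atTop (𝓝 0) := by
    have h1 := (R.tendsto_rho_rpow (s := θ.ς - θ.σ) (by linarith [hς.1])).const_mul c₁
    have h2 := (R.tendsto_rho_rpow (s := 1 - 2 * θ.σ) (by linarith [hσ.2])).const_mul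
      ((K : ℝ) / 2 * c₂)
    simpa using h1.add h2
  filter_upwards [(tendsto_comap_nhds R.x z).eventually (Metric.ball_mem_nhds z hr),
    (R.tendsto_y_comap z).eventually (Metric.ball_mem_nhds z hr),
    R.eventually_switch.filter_mono inf_le_left,
    (hsmall.eventually_lt_const (show (0 : ℝ) < θ.b₁ / 2 by positivity)).filter_mono inf_le_left]
    with k hxk hyk hs hk
  have hxy : R.x k + R.d k = R.y k := by simp [Run.d]
  have hTaylor := le_of_hess_lipschitz P.contDiff_f (convex_ball z r) (K := K)
    (fun a ha b hb => by
      simpa [dist_eq_norm] using hK.dist_le_mul a (hball ha) b (hball hb)) K.coe_nonneg hxk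
    (d := R.d k) (by rwa [hxy])
  obtain ⟨w, -, hw, hwN⟩ := R.exists_residual hs (hM k hs)
  have hN := hwN.2 _ (P.mem_Pi_self (R.x_mem_Ω k))
  have e1 : R.x k - R.y k = -R.d k := by simp [Run.d]
  rw [e1, inner_neg_right, inner_sub_left, inner_add_left, real_inner_comm (R.d k)
    (Matrix.toEuclideanLin (R.G k) (R.d k))] at hN
  have hQ1 := (hM k hs).hess_add_le_inner (R.d k)
  have hQ2 := (hM k hs).le_inner (R.d k)
  set Q := inner ℝ (R.d k) (Matrix.toEuclideanLin (R.G k) (R.d k)) with hQ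
  set q := inner ℝ (gradient P.f (R.x k)) (R.d k) with hq
  have hρ := R.rho_pos k
  set A := R.rho k ^ θ.σ with hA
  have hA0 : 0 < A := Real.rpow_pos_of_pos hρ _
  have hd0 := norm_nonneg (R.d k)
  have hw' : inner ℝ w (R.d k) ≤ c₁ * R.rho k ^ (θ.ς - θ.σ) * A * ‖R.d k‖ ^ 2 := by
    have e2 : R.rho k ^ (1 + θ.ς) = R.rho k ^ (θ.ς - θ.σ) * A * R.rho k := by
      rw [hA, ← Real.rpow_add hρ, ← Real.rpow_add_one hρ.ne']
      congr 1
      ring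
    have h1 : ‖w‖ ≤ R.rho k ^ (θ.ς - θ.σ) * A * (c₁ * ‖R.d k‖) := by
      refine hw.trans ?_
      rw [e2]
      have := (hc k hs).1
      gcongr
    have h2 := (real_inner_le_norm w (R.d k)).trans (mul_le_mul_of_nonneg_right h1 hd0)
    linarith
  have hd3 : K / 2 * ‖R.d k‖ ^ 3 ≤ K / 2 * c₂ * R.rho k ^ (1 - 2 * θ.σ) * A * ‖R.d k‖ ^ 2 := by
    have e3 : R.rho k ^ (1 - θ.σ) = R.rho k ^ (1 - 2 * θ.σ) * A := by
      rw [hA, ← Real.rpow_add hρ]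
      congr 1
      ring
    have h1 := hd k hs
    rw [e3] at h1
    have h2 := mul_le_mul_of_nonneg_right h1 (sq_nonneg ‖R.d k‖)
    have h3 := mul_le_mul_of_nonneg_left h2 (show (0 : ℝ) ≤ K / 2 by positivity)
    have e4 : ‖R.d k‖ ^ 3 = ‖R.d k‖ * ‖R.d k‖ ^ 2 := by ring
    rw [e4]
    linarith
  have hkA : (c₁ * R.rho k ^ (θ.ς - θ.σ) + K / 2 * c₂ * R.rho k ^ (1 - 2 * θ.σ)) *
      (A * ‖R.d k‖ ^ 2) ≤ θ.b₁ / 2 * (A * ‖R.d k‖ ^ 2) := by gcongr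
  have hQ0 : 0 ≤ Q := le_trans (by positivity) hQ2
  have hwpos : 0 ≤ c₁ * R.rho k ^ (θ.ς - θ.σ) * A * ‖R.d k‖ ^ 2 := by positivity
  -- The residual condition tested at xᵏ gives q ≤ -Q + ⟨w, d⟩, and the Hessian form is at most Q -
  -- b₁ρ^σ‖d‖². What remains is -(1/2 - ϱ)Q ≤ 0 and errors absorbed by (b₁/2)ρ^σ‖d‖².
  have hunit : P.f (R.x k + R.d k) ≤ P.f (R.x k) + θ.ϱ * q := by
    have h1 : (1 - θ.ϱ) * q ≤
        (1 - θ.ϱ) * (-Q + c₁ * R.rho k ^ (θ.ς - θ.σ) * A * ‖R.d k‖ ^ 2) := by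
      have : 0 ≤ 1 - θ.ϱ := by linarith [hϱ.2]
      gcongr
      linarith
    have h2 : 0 ≤ (1 / 2 - θ.ϱ) * Q := mul_nonneg (by linarith [hϱ.2]) hQ0
    have h3 : 0 ≤ θ.ϱ * (c₁ * R.rho k ^ (θ.ς - θ.σ) * A * ‖R.d k‖ ^ 2) :=
      mul_nonneg hϱ.1.le hwpos
    linarith
  have ht0 : R.t k ≤ 0 := (R.newton_search k hs).2 (by
    change P.f (R.x k + θ.β ^ 0 • R.d k) ≤ P.f (R.x k) + θ.ϱ * θ.β ^ 0 * q
    simpa using hunit)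
  rw [R.newton_step k hs, Nat.le_zero.1 ht0, pow_zero, one_smul, add_sub_cancel]

/-- There are normal vectors at the points `yᵏ` asymptotic to `-∇f(xᵏ)`. -/
theorem exists_normal_seq : ∃ v : ℕ → E n,
    (∀ᶠ k in atTop, v k ∈ normalCone R.PiStar (R.y k)) ∧
      Tendsto (fun k => v k + gradient P.f (R.x k)) atTop (𝓝 0) := by
  obtain ⟨M, -, hM⟩ := R.exists_isModelMatrix
  obtain ⟨a, -, hPi⟩ := R.exists_PiStar_eq
  have hex : ∀ k, ∃ v : E n, P.Switch (R.x k) (R.xbar k) →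
      v ∈ normalCone (P.Pi (R.x k)) (R.y k) ∧
        ‖v + gradient P.f (R.x k)‖ ≤ 3 / 4 * R.rho k + M * ‖R.d k‖ := by
    intro k
    by_cases hs : P.Switch (R.x k) (R.xbar k)
    · obtain ⟨w, hw, -, hwN⟩ := R.exists_residual hs (hM k hs)
      refine ⟨_, fun _ => ⟨hwN, ?_⟩⟩
      rw [show w - (gradient P.f (R.x k) + Matrix.toEuclideanLin (R.G k) (R.d k))
        + gradient P.f (R.x k) = w - Matrix.toEuclideanLin (R.G k) (R.d k) by abel]
      exact (norm_sub_le _ _).trans (add_le_add hw ((hM k hs).norm_le _))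
    · exact ⟨0, fun h => absurd h hs⟩
  choose v hv using hex
  refine ⟨v, ?_, ?_⟩
  · filter_upwards [R.eventually_switch, hPi] with k hs hk
    rw [← hk.1]
    exact (hv k hs).1
  · have h := (R.tendsto_rho.const_mul (3 / 4)).add
      ((tendsto_zero_iff_norm_tendsto_zero.1 R.tendsto_d).const_mul M)
    rw [mul_zero, mul_zero, add_zero] at h
    exact squeeze_zero_norm' (R.eventually_switch.mono fun k hk => (hv k hk).2) h

/-- Identification of the active face: eventually the Newton direction is orthogonal to the normal
cone at the iterate. -/
theorem eventually_inner_normal_d_eq_zero (hLip : R.HessLocallyLipschitz)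
    (hri : R.NonDegenerate) :
    ∀ᶠ k in atTop, ∀ ξ ∈ normalCone R.PiStar (R.x k), inner ℝ ξ (R.d k) = 0 := by
  obtain ⟨v, hvN, hv⟩ := R.exists_normal_seq
  refine eventually_of_forall_comap_nhds P.isCompact_Ω (Eventually.of_forall R.x_mem_Ω)
    fun z hz => ?_
  obtain ⟨v₀, hv₀, hv₀g⟩ := hri z hz
  have hv₀' : v₀ = -gradient P.f z := eq_neg_of_add_eq_zero_right hv₀g
  have hsub := R.eventually_normalCone_PiStar_subset hz
  have hident := eventually_inner_sub_eq_zero hsub hv₀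
  have hx := tendsto_comap_nhds R.x z
  have hg := continuous_gradient_of_contDiff_two P.contDiff_f
  have hv1 : Tendsto v (atTop ⊓ comap R.x (𝓝 z)) (𝓝 v₀) := by
    have := (hv.mono_left inf_le_left).sub ((hg.tendsto z).comp hx)
    simpa [hv₀'] using this
  have hpred : Tendsto (fun k : ℕ => k - 1) (atTop ⊓ comap R.x (𝓝 z)) atTop :=
    (tendsto_sub_atTop_nat 1).mono_left inf_le_left
  -- The unit step makes xᵏ itself a Newton point, so the normals found at yᵏ⁻¹ are normals at xᵏ.
  have hxpred : ∀ᶠ k in atTop ⊓ comap R.x (𝓝 z), R.x k = R.y (k - 1) := by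
    filter_upwards [hpred.eventually (R.eventually_x_succ_eq_y hLip),
      (eventually_ge_atTop 1).filter_mono inf_le_left] with k hk hk1
    rwa [Nat.sub_add_cancel hk1] at hk
  have hy' : Tendsto (fun k => R.y (k - 1)) (atTop ⊓ comap R.x (𝓝 z)) (𝓝 z) :=
    hx.congr' hxpred
  have hx' : Tendsto (fun k => R.x (k - 1)) (atTop ⊓ comap R.x (𝓝 z)) (𝓝 z) := by
    have := hy'.sub (R.tendsto_d.comp hpred)
    simpa [Run.d, Function.comp_def] using this
  have hv2 : Tendsto (fun k => v (k - 1)) (atTop ⊓ comap R.x (𝓝 z)) (𝓝 v₀) := by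
    have := (hv.comp hpred).sub ((hg.tendsto z).comp hx')
    simpa [hv₀', Function.comp_def] using this
  -- Face identification is applied at yᵏ and at yᵏ⁻¹ = xᵏ; subtracting gives orthogonality of dᵏ to
  -- the cone at `z`, which contains the cone at xᵏ.
  filter_upwards [(hv1.prodMk (R.tendsto_y_comap z)).eventually hident,
    (hv2.prodMk hy').eventually hident, hvN.filter_mono inf_le_left, hpred.eventually hvN, hxpred,
    hx.eventually hsub] with k h1 h2 h3 h4 h5 h6 ξ hξ
  have e1 := h1 h3 ξ (h6 hξ)
  have e2 := h2 h4 ξ (h6 hξ)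
  simp only [← h5] at e2
  have e3 : R.d k = (R.y k - z) - (R.x k - z) := by simp [Run.d]
  rw [e3, inner_sub_right, e1, e2, sub_zero]

/-- Sufficient decrease relative to the subdifferential of `φ`. -/
theorem exists_eventually_decrease (hLip : R.HessLocallyLipschitz) (hri : R.NonDegenerate)
    (hangle : R.AngleCondition) : ∃ c : ℝ, 0 < c ∧ ∃ ξ : ℕ → E n,
      (∀ᶠ k in atTop, ξ k ∈ normalCone R.PiStar (R.x k)) ∧
      ∀ᶠ k in atTop, P.f (R.x (k + 1)) ≤
        P.f (R.x k) - c * (‖gradient P.f (R.x k) + ξ k‖ * ‖R.x (k + 1) - R.x k‖) := by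
  obtain ⟨ξ, hξ, hlim⟩ := hangle
  obtain ⟨c, hc0, hc⟩ := exists_between hlim
  -- A real `liminf` carries information only for a sequence bounded below; Cauchy–Schwarz provides
  -- the bound -1.
  have hev := eventually_lt_of_lt_liminf hc ⟨-1, by
    rw [eventually_map]
    refine Eventually.of_forall fun k => ?_
    change (-1 : ℝ) ≤ _
    rw [neg_div, neg_le_neg_iff]
    exact div_le_one_of_le₀ (real_inner_le_norm _ _) (by positivity)⟩
  have hϱ := θ.ϱ_mem.1
  refine ⟨θ.ϱ * c, mul_pos hϱ hc0, ξ, hξ, ?_⟩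
  filter_upwards [hev, hξ, R.eventually_switch, R.eventually_inner_normal_d_eq_zero hLip hri]
    with k hk hξk hs horth
  have h1 := R.f_succ_le hs
  have hβ := (beta_pow_mem (θ := θ) (R.t k)).1
  have hnorm : ‖R.x (k + 1) - R.x k‖ = θ.β ^ R.t k * ‖R.d k‖ := by
    rw [R.newton_step k hs, add_sub_cancel_left, norm_smul, Real.norm_eq_abs, abs_of_pos hβ]
    rfl
  have h2 : c * (‖gradient P.f (R.x k) + ξ k‖ * ‖R.d k‖) ≤
      -inner ℝ (gradient P.f (R.x k)) (R.d k) := by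
    have hpos : 0 < ‖gradient P.f (R.x k) + ξ k‖ * ‖R.d k‖ := by
      -- A zero denominator would make the quotient 0 by convention, against its being larger than
      -- `c`.
      refine lt_of_le_of_ne (by positivity) fun h0 => ?_
      rw [← h0, div_zero] at hk
      linarith
    rw [lt_div_iff₀ hpos, inner_add_left, horth _ hξk, add_zero] at hk
    exact hk.le
  rw [hnorm]
  have h3 := mul_le_mul_of_nonneg_left h2 (mul_pos hϱ hβ).le
  linarith

end Run

/-! ### Finite length from the Kurdyka-Łojasiewicz inequality -/

theorem IsDesingularizing.deriv_mul_sub_le {η : EReal} {ψ : ℝ → ℝ} (h : IsDesingularizing η ψ)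
    {s t : ℝ} (hs : 0 ≤ s) (hst : s ≤ t) (ht0 : 0 < t) (ht : (t : EReal) < η) :
    deriv ψ t * (t - s) ≤ ψ t - ψ s := by
  rcases hst.eq_or_lt with rfl | hlt
  · simp
  have hopen : IsOpen {s : ℝ | 0 < s ∧ (s : EReal) < η} :=
    isOpen_Ioi.inter (isOpen_Iio.preimage continuous_coe_real_ereal)
  have hdiff : DifferentiableAt ℝ ψ t :=
    (h.contDiffOn.differentiableOn (by norm_num)).differentiableAt (hopen.mem_nhds ⟨ht0, ht⟩)
  have := h.concaveOn.deriv_le_slope ⟨hs, (EReal.coe_le_coe_iff.2 hst).trans_lt ht⟩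
    ⟨ht0.le, ht⟩ hlt hdiff
  rwa [slope_def_field, le_div_iff₀ (sub_pos.2 hlt)] at this

/-- Finite length of a sequence satisfying a sufficient decrease condition and a
Kurdyka-Łojasiewicz inequality near a cluster point. Here `v` is the sequence of gaps of function
values and `s` bounds the slopes from above. -/
theorem summable_norm_sub_of_KL {X : Type*} [SeminormedAddCommGroup X] {x : ℕ → X} {z : X}
    {v s : ℕ → ℝ} {c : ℝ} {η : EReal} {ψ : ℝ → ℝ} {U : Set X} (hψ : IsDesingularizing η ψ)
    (hη : 0 < η) (hU : U ∈ 𝓝 z) (hz : MapClusterPt z atTop x) (hc : 0 < c)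
    (hv0 : ∀ k, 0 < v k) (hv : Tendsto v atTop (𝓝 0)) (hs : ∀ k, 0 ≤ s k)
    (hdec : ∀ᶠ k in atTop, v (k + 1) ≤ v k - c * (s k * ‖x (k + 1) - x k‖))
    (hKL : ∀ᶠ k in atTop, x k ∈ U → (v k : EReal) < η → 1 ≤ deriv ψ (v k) * s k) :
    Summable fun k => ‖x (k + 1) - x k‖ := by
  obtain ⟨r, hr, hball⟩ := Metric.mem_nhds_iff.1 hU
  have hvη : ∀ᶠ k in atTop, (v k : EReal) < η :=
    ((continuous_coe_real_ereal.tendsto 0).comp hv).eventually (isOpen_Iio.mem_nhds hη)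
  have hψv : Tendsto (fun k => ψ (v k)) atTop (𝓝 0) := by
    have h1 : Tendsto v atTop (𝓝[{s : ℝ | 0 ≤ s ∧ (s : EReal) < η}] 0) :=
      tendsto_nhdsWithin_iff.2 ⟨hv, hvη.mono fun k hk => ⟨(hv0 k).le, hk⟩⟩
    have h2 := (hψ.continuousOn 0 ⟨le_rfl, hη⟩).tendsto.comp h1
    rwa [hψ.zero] at h2
  obtain ⟨K, hK⟩ := eventually_atTop.1 ((hdec.and hKL).and hvη)
  have hfreq : ∃ᶠ k in atTop, x k ∈ Metric.ball z (r / 2) :=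
    hz.frequently (Metric.ball_mem_nhds z (half_pos hr))
  -- Start within r/2 of `z` with ψ(v) < cr/2: the whole remaining length is then below r/2, so the
  -- iterates cannot leave the ball.
  obtain ⟨k₀, hk₀, hψk₀, hKk₀⟩ := (hfreq.and_eventually
    ((hψv.eventually_lt_const (show (0 : ℝ) < c * (r / 2) by positivity)).and
      (eventually_ge_atTop K))).exists
  -- Concavity gives ψ(vₖ) - ψ(vₖ₊₁) ≥ ψ'(vₖ)(vₖ - vₖ₊₁) ≥ ψ'(vₖ)·c·sₖ‖xₖ₊₁ - xₖ‖, and the KL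
  -- inequality says ψ'(vₖ)sₖ ≥ 1.
  have hstep : ∀ k ≥ k₀, x k ∈ U → c * ‖x (k + 1) - x k‖ ≤ ψ (v k) - ψ (v (k + 1)) := by
    intro k hk hxU
    obtain ⟨⟨h1, h2⟩, h3⟩ := hK k (hKk₀.trans hk)
    have h4 := h2 hxU h3
    have h5 : 0 ≤ c * (s k * ‖x (k + 1) - x k‖) :=
      mul_nonneg hc.le (mul_nonneg (hs k) (norm_nonneg _))
    have h6 := hψ.deriv_mul_sub_le (hv0 (k + 1)).le (by linarith) (hv0 k) h3
    have h7 : deriv ψ (v k) * (c * (s k * ‖x (k + 1) - x k‖)) ≤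
        deriv ψ (v k) * (v k - v (k + 1)) :=
      mul_le_mul_of_nonneg_left (by linarith) (hψ.deriv_pos _ (hv0 k) h3).le
    have h8 : 1 * (c * ‖x (k + 1) - x k‖) ≤ deriv ψ (v k) * s k * (c * ‖x (k + 1) - x k‖) :=
      mul_le_mul_of_nonneg_right h4 (by positivity)
    linarith
  have hψ0 : ∀ N, 0 ≤ ψ (v (k₀ + N)) := fun N =>
    hψ.nonneg _ (hv0 _).le (hK _ (by omega)).2
  have hsum : ∀ N, c * ∑ i ∈ Finset.range N, ‖x (k₀ + i + 1) - x (k₀ + i)‖ ≤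
      ψ (v k₀) - ψ (v (k₀ + N)) := by
    intro N
    induction N with
    | zero => simp
    | succ N ih =>
      -- The length bound for the first N steps keeps the next point in the ball, which licenses one
      -- more use of `hstep`.
      have hmem : x (k₀ + N) ∈ U := by
        refine hball ?_
        have h1 : dist (x k₀) (x (k₀ + N)) ≤
            ∑ i ∈ Finset.range N, ‖x (k₀ + i + 1) - x (k₀ + i)‖ := by
          refine (dist_le_range_sum_dist (fun i => x (k₀ + i)) N).trans_eq ?_
          exact Finset.sum_congr rfl fun i _ => by rw [dist_comm, dist_eq_norm]; rfl
        have h2 : ∑ i ∈ Finset.range N, ‖x (k₀ + i + 1) - x (k₀ + i)‖ < r / 2 := by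
          refine lt_of_mul_lt_mul_left ?_ hc.le
          linarith [hψ0 N]
        rw [Metric.mem_ball] at hk₀ ⊢
        have h3 := dist_triangle_left (x (k₀ + N)) z (x k₀)
        linarith
      have := hstep (k₀ + N) (by omega) hmem
      rw [Finset.sum_range_succ, mul_add]
      rw [← add_assoc]
      linarith
  rw [← summable_nat_add_iff k₀]
  refine summable_of_sum_range_le (c := ψ (v k₀) / c) (fun _ => norm_nonneg _) fun N => ?_
  rw [le_div_iff₀ hc, mul_comm]
  have h1 := hsum N
  have h2 := hψ0 N
  simp only [add_comm k₀] at h1 h2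
  simp only [add_right_comm _ k₀ 1]
  simp only [add_right_comm _ k₀ 1] at h1
  linarith

/-! ### Finite length of the iterates and L-stationarity of their limit. -/

namespace Run

variable {n p : ℕ} {P : Problem n p} {θ : Params} (R : Run P θ)

theorem exists_mapClusterPt : ∃ z, MapClusterPt z atTop R.x := by
  obtain ⟨z, -, hz⟩ := P.isCompact_Ω.exists_mapClusterPt (f := atTop) (u := R.x)
    (le_principal_iff.2 (mem_map.2 (Eventually.of_forall R.x_mem_Ω)))
  exact ⟨z, hz⟩

/-- The gap between `F(xᵏ)` and its limit. It is eventually that of `f` at a cluster point. -/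
theorem exists_gap {z : E n} (hz : MapClusterPt z atTop R.x) : ∃ v : ℕ → ℝ, (∀ k, 0 < v k) ∧
    Tendsto v atTop (𝓝 0) ∧ ∀ᶠ k in atTop, P.f (R.x k) = P.f z + v k := by
  obtain ⟨c, hc⟩ := R.exists_tendsto_F
  obtain ⟨a, -, hpen⟩ := R.exists_PiStar_eq
  refine ⟨fun k => P.F (R.x k) - c, fun k => ?_, by simpa using hc.sub_const c, ?_⟩
  · have h1 : c ≤ P.F (R.x (k + 1)) := R.strictAnti_F.antitone.le_of_tendsto hc (k + 1)
    have h2 : P.F (R.x (k + 1)) < P.F (R.x k) := R.strictAnti_F (Nat.lt_succ_self k)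
    linarith
  · have hf : Tendsto (fun k => P.f (R.x k)) atTop (𝓝 (c - P.pen a)) := by
      refine (hc.sub_const (P.pen a)).congr' ?_
      filter_upwards [hpen] with k hk
      rw [Problem.F, hk.2, add_sub_cancel_right]
    have := neBot_inf_comap_of_mapClusterPt hz
    have heq : P.f z = c - P.pen a := tendsto_nhds_unique
      ((P.contDiff_f.continuous.tendsto z).comp (tendsto_comap_nhds R.x z))
      (hf.mono_left inf_le_left)
    filter_upwards [hpen] with k hk
    rw [Problem.F, hk.2, heq]
    ring

theorem hasGradientAt_f (x : E n) : HasGradientAt P.f (gradient P.f x) x :=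
  (differentiableAt_of_contDiff_two P.contDiff_f x).hasGradientAt

/-- Needed to place the cluster point in dom ∂φ, where the KL property is available. -/
theorem limitingSubdiff_phi_nonempty (hri : R.NonDegenerate) {z : E n}
    (hz : MapClusterPt z atTop R.x) : (limitingSubdiff R.phi z).Nonempty := by
  obtain ⟨v, hv, -⟩ := hri z hz
  exact ⟨_, gradient_add_mem_limitingSubdiff (hasGradientAt_f z) (intrinsicInterior_subset hv)⟩

theorem summable_norm_sub (hLip : R.HessLocallyLipschitz) (hri : R.NonDegenerate)
    (hangle : R.AngleCondition) (hKL : IsKLFunction R.phi) :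
    Summable fun k => ‖R.x (k + 1) - R.x k‖ := by
  obtain ⟨z, hz⟩ := R.exists_mapClusterPt
  obtain ⟨η, hη, U, hU, ψ, hψ, hineq⟩ := hKL.2.2 z (R.limitingSubdiff_phi_nonempty hri hz)
  obtain ⟨c, hc, ξ, hξ, hdec⟩ := R.exists_eventually_decrease hLip hri hangle
  obtain ⟨v, hv0, hv, hfv⟩ := R.exists_gap hz
  refine summable_norm_sub_of_KL (s := fun k => ‖gradient P.f (R.x k) + ξ k‖) hψ hη hU hz hc hv0 hv
    (fun k => norm_nonneg _) ?_ ?_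
  · filter_upwards [hdec, hfv, (tendsto_add_atTop_nat 1).eventually hfv] with k h1 h2 h3
    rw [h2, h3] at h1
    linarith
  · filter_upwards [hξ, hfv] with k hξk hk hxU hvη
    have hphiz : R.phi z = P.f z :=
      coe_add_indicatorFun_of_mem _ (R.mem_PiStar_of_mapClusterPt hz)
    have hphik : R.phi (R.x k) = ((P.f z + v k : ℝ) : EReal) := by
      rw [← hk]
      exact coe_add_indicatorFun_of_mem _ hξk.1
    have h := hineq _ hxU
    rw [hphiz, hphik, EReal.toReal_coe, EReal.toReal_coe, add_sub_cancel_left,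
      EReal.coe_lt_coe_iff, EReal.coe_add] at h
    have h1 := h (lt_add_of_pos_right _ (hv0 k)) (EReal.add_lt_add_left_coe hvη _)
    -- ∇f(xᵏ) + ξₖ is a subgradient of φ at xᵏ, so its norm may replace the distance in the KL
    -- inequality.
    have h2 : Metric.infEDist 0 (limitingSubdiff R.phi (R.x k)) ≤
        ENNReal.ofReal ‖gradient P.f (R.x k) + ξ k‖ := by
      have := Metric.infEDist_le_edist_of_mem (x := 0)
        (gradient_add_mem_limitingSubdiff (hasGradientAt_f (P := P) (R.x k)) hξk)
      rwa [edist_comm, edist_zero_right, ← ofReal_norm] at this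
    have h3 := h1.trans (mul_le_mul_right h2 _)
    rwa [← ENNReal.ofReal_mul (hψ.deriv_pos _ (hv0 k) hvη).le, ENNReal.one_le_ofReal] at h3

theorem exists_tendsto_isLStationary (h : Summable fun k => ‖R.x (k + 1) - R.x k‖) :
    ∃ z, Tendsto R.x atTop (𝓝 z) ∧ P.IsLStationary z := by
  have hcauchy : CauchySeq R.x := cauchySeq_of_summable_dist (by
    refine h.congr fun k => ?_
    rw [dist_comm, dist_eq_norm])
  obtain ⟨z, hz⟩ := cauchySeq_tendsto_of_complete hcauchy
  obtain ⟨M, hM⟩ := R.exists_mubar_le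
  have hxbar : Tendsto R.xbar atTop (𝓝 z) := by
    simpa using hz.sub R.tendsto_x_sub_xbar
  exact ⟨z, hz, P.isLStationary_of_tendsto hz hxbar (R.mem_Ω_of_mapClusterPt hz.mapClusterPt)
    R.mubar_pos hM R.xbar_mem_pgPoints⟩

end Run

end PGiPN

end

theorem theorem5p1 {n p : ℕ} (P : PGiPN.Problem n p) (θ : PGiPN.Params) (R : PGiPN.Run P θ)
    (hLip : R.HessLocallyLipschitz) (hri : R.NonDegenerate) (hangle : R.AngleCondition)
    (hKL : PGiPN.IsKLFunction R.phi) :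
    Summable (fun k => ‖R.x (k + 1) - R.x k‖) ∧
      ∃ xstar : PGiPN.E n, Filter.Tendsto R.x Filter.atTop (nhds xstar) ∧
        P.IsLStationary xstar := by
  have h := R.summable_norm_sub hLip hri hangle hKL
  exact ⟨h, R.exists_tendsto_isLStationary h⟩
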